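/- \textbf{Theorem (Stable oscillations in gradient descent).} Let $\mathcal{L}\colon\mathbb{R}^d\to\mathbb{R}$ have a local minimizer $x^*$ at which $\mathcal{L}$ is four times differentiable (the derivatives of order at most three exist in a neighbourhood of $x^*$, and $\mathcal{D}^3\mathcal{L}$ is differentiable at $x^*$). Assume that $\nabla^2\mathcal{L}(x^*)$ is positive definite, that its largest eigenvalue $\lambda_{\max}$ is simple with $\lambda_{\max}=2/\eta$ (edge of stability), and let $v_{\max}\neq 0$ be a corresponding eigenvector. Put $$q=\big[\nabla^2\mathcal{L}(x^*)\big]^{-1}\,\nabla_{v}\,\mathcal{D}^3\mathcal{L}(x^*)[v]^3\Big|_{v=v_{\max}},$$ where $\mathcal{D}^k\mathcal{L}(x^*)$ is the $k$-th derivative as a $k$-linear form and $[v]^p$ means that $p$ of its arguments equal $v$. Assume the non-degeneracy condition $\mathcal{D}^3\mathcal{L}(x^*)[v_{\max}]^2[q]\neq\mathcal{D}^4\mathcal{L}(x^*)[v_{\max}]^4$. For a step size $\eta'$ let $\psi_{\eta'}(x)=x-\eta'\nabla\mathcal{L}(x)$. A stable period-2 cycle of $\psi_{\eta'}$ is a pair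 $x^{(1)}\neq x^{(2)}$ with $\psi_{\eta'}(x^{(1)})=x^{(2)}$ and $\psi_{\eta'}(x^{(2)})=x^{(1)}$ such that $x^{(1)}$ and $x^{(2)}$ are asymptotically stable (Lyapunov stable and locally attracting) fixed points of $\psi_{\eta'}\circ\psi_{\eta'}$. Then the following are equivalent: \begin{enumerate} \item for step sizes slightly above $\eta$, gradient descent has a stable period-2 cycle in the vicinity of $x^*$: for every neighbourhood $U$ of $x^*$ there is $\delta>0$ such that for every $\eta'\in(\eta,\eta+\delta)$ the map $\psi_{\eta'}$ has a stable period-2 cycle contained in $U$; \item for every neighbourhood $U$ of $x^*$ and every $\delta>0$ there is some $\eta'\in(\eta,\eta+\delta)$ for which $\psi_{\eta'}$ has a stable period-2 cycle contained in $U$; \item $\mathcal{D}^3\mathcal{L}(x^*)[v_{\max}]^2[q]>\mathcal{D}^4\mathcal{L}(x^*)[v_{\max}]^4.$ \end{enumerate} -/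

import Mathlib

open Filter Topology

/-- `ℝ^d` with its Euclidean structure. -/
abbrev RSpace (d : ℕ) : Type := EuclideanSpace ℝ (Fin d)

/-- `f` is `n` times differentiable at the point `x` (Fréchet sense): the derivatives of order
`< n` exist on a neighbourhood of `x`, and the `n`-th derivative exists at `x`. No continuity of
the `n`-th derivative, nor its existence away from `x`, is required. -/
def TimesDifferentiableAt {d : ℕ} (n : ℕ) (f : RSpace d → ℝ) (x : RSpace d) : Prop :=
  (∀ k : ℕ, k + 1 < n → ∀ᶠ y in 𝓝 x, DifferentiableAt ℝ (iteratedFDeriv ℝ k f) y) ∧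
  (∀ k : ℕ, k < n → DifferentiableAt ℝ (iteratedFDeriv ℝ k f) x)

/-- The Hessian of `L` at `x`, as an operator on `ℝ^d`: the Jacobian of the gradient field. -/
noncomputable def hessianOp {d : ℕ} (L : RSpace d → ℝ) (x : RSpace d) :
    RSpace d →L[ℝ] RSpace d :=
  fderiv ℝ (gradient L) x

/-- One step of gradient descent on `L` with step size `η`. -/
noncomputable def gdStep {d : ℕ} (L : RSpace d → ℝ) (η : ℝ) (x : RSpace d) : RSpace d :=
  x - η • gradient L x

/-- `p` is an asymptotically stable fixed point of `f`: it is fixed, Lyapunov stable, and attracts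
all points of some neighbourhood. -/
def IsAsymptoticallyStableFixedPt {d : ℕ} (f : RSpace d → RSpace d) (p : RSpace d) : Prop :=
  Function.IsFixedPt f p ∧
  (∀ U ∈ 𝓝 p, ∃ V ∈ 𝓝 p, ∀ x ∈ V, ∀ n : ℕ, f^[n] x ∈ U) ∧
  (∀ᶠ x in 𝓝 p, Tendsto (fun n : ℕ => f^[n] x) atTop (𝓝 p))

/-- `x₁ ↦ x₂ ↦ x₁` is a stable cycle of `ψ` of (exact) period 2: both of its points are
asymptotically stable fixed points of the second iterate. -/
def IsStableTwoCycle {d : ℕ} (ψ : RSpace d → RSpace d) (x₁ x₂ : RSpace d) : Prop :=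
  x₁ ≠ x₂ ∧ ψ x₁ = x₂ ∧ ψ x₂ = x₁ ∧
  IsAsymptoticallyStableFixedPt ψ^[2] x₁ ∧ IsAsymptoticallyStableFixedPt ψ^[2] x₂

/-- Gradient descent on `L` with step size `η` has a stable period-2 cycle inside `U`. -/
def HasStableTwoCycleIn {d : ℕ} (L : RSpace d → ℝ) (η : ℝ) (U : Set (RSpace d)) : Prop :=
  ∃ x₁ ∈ U, ∃ x₂ ∈ U, IsStableTwoCycle (gdStep L η) x₁ x₂

/-- The vector `q = (∇²L(x))⁻¹ ∇_w (D³L(x)[w]³)` evaluated at `w = v`. -/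
noncomputable def qVec {d : ℕ} (L : RSpace d → ℝ) (x v : RSpace d) : RSpace d :=
  (hessianOp L x).inverse (gradient (fun w => iteratedFDeriv ℝ 3 L x (fun _ => w)) v)

/-!
Write `c = 2 / η'`. The points `x₁ = x* + m + s` and `x₂ = x* + m - s` form a two-cycle of gradient
descent exactly when, for the field `g y = ∇L (x* + y)`,
`g (m + s) + g (m - s) = 0` and `g (m + s) - g (m - s) = 2 c s`.
Let `H`, `B`, `C` be the first three derivatives of `g` at `0`, `v` the unit top eigenvector of `H`,
with eigenvalue `c₀ = 2 / η`, and `p = H⁻¹ B v v`, which is `q / 3` up to normalisation.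

*Reduction.* Since `H` is invertible, the first equation makes `m` quadratic in `s`; since `H - c₀`
is invertible on the complement of `v`, the second one gives `s = a v + O(a³)` with `a = ⟪v, s⟫`, and
then `m = -(a² / 2) p + O(a³)`. The component along `v` of the second equation becomes
`c₀ - c = κ a² + o(a²)` with `κ = ⟪v, B v p⟫ / 2 - ⟪v, C v v v⟫ / 6`, a positive multiple of
`D³L[v]²[q] - D⁴L[v]⁴` (`IsNearCycle.reduction`, `IsNearCycle.parameter_expansion`).

*Subcritical case.* If `κ < 0`, nearby cycles need `c > c₀`, so there are none for `η' > η`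
(`IsFlipJet.exists_not_hasStableTwoCycleIn`).

*Existence.* All equations but the component along `v` of the second one are solved for `(m, s)` in
terms of `(a, c)` by the implicit function theorem (`IsFlipJet.exists_branch`). If `κ > 0` and
`c < c₀`, the remaining component changes sign near `a = √((c₀ - c) / κ)`, and the intermediate value
theorem yields a cycle (`IsFlipJet.exists_cycles`).

*Stability.* Let `J` be the derivative of the second iterate at a point of the cycle. It is an
`O(a)` perturbation of `(1 - (2 / c₀) H)²`, which fixes `v` and contracts its complement, whereas the
margin of stability is only of order `a²`. The tangent vector `u = v - a p` of the branch of cycles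
absorbs the first-order effects: `J u = u + a² y + o(a²)` with `⟪v, y⟫ = -8 κ / c₀`. In the norm
`|α| + M |a| ‖w‖` of `α u + w`, `w ⟂ v`, the operator `J` is then a strict contraction when `κ > 0`
(`IsNearCycle.eventually_hasAdaptedContraction`), which gives asymptotic stability.

Besides strict differentiability of `g` at `0`, only the Taylor expansions at `0` of `g` to third
order and of its derivative to second order enter (`taylor_of_differentiableAt_three`); they need no
continuity of the fourth derivative of `L`.
-/

/-! ### Taylor expansions obtained by integrating along rays -/

section Taylor

variable {E W : Type*} [NormedAddCommGroup E] [NormedSpace ℝ E]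
  [NormedAddCommGroup W] [NormedSpace ℝ W]

/-- Integration of a Taylor expansion: if `F'` agrees with `K` to order `n`, and `Q` is a primitive
of `K` along every ray issued from `0`, then `F` agrees with `Q` to order `n + 1`. Working along
rays makes the symmetry of the Taylor coefficients unnecessary. -/
lemma isLittleO_sub_of_fderiv_isLittleO {F Q : E → W} {F' K : E → E →L[ℝ] W} {n : ℕ}
    (hF : ∀ᶠ x in 𝓝 0, HasFDerivAt F (F' x) x)
    (hK : (fun x => F' x - K x) =o[𝓝 0] fun x => ‖x‖ ^ n)
    (hQ : ∀ (x : E) (t : ℝ), HasDerivAt (fun t : ℝ => Q (t • x)) (K (t • x) x) t)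
    (h0 : F 0 = Q 0) :
    (fun x => F x - Q x) =o[𝓝 0] fun x => ‖x‖ ^ (n + 1) := by
  rw [Asymptotics.isLittleO_iff]
  intro ε hε
  obtain ⟨r, hr, hball⟩ := Metric.eventually_nhds_iff.1 (hF.and (hK.def hε))
  refine Metric.eventually_nhds_iff.2 ⟨r, hr, fun x hx => ?_⟩
  have hin : ∀ t ∈ Set.Icc (0 : ℝ) 1, dist (t • x) 0 < r := fun t ht => by
    rw [dist_zero_right] at hx ⊢
    rw [norm_smul, Real.norm_of_nonneg ht.1]
    exact (mul_le_of_le_one_left (norm_nonneg _) ht.2).trans_lt hx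
  have hder : ∀ t ∈ Set.Icc (0 : ℝ) 1, HasDerivWithinAt (fun t : ℝ => F (t • x) - Q (t • x))
      ((F' (t • x) - K (t • x)) x) (Set.Icc 0 1) t := fun t ht => by
    have h1 : HasDerivAt (fun t : ℝ => t • x) x t := by
      simpa using (hasDerivAt_id t).smul_const x
    exact (((hball (hin t ht)).1.comp_hasDerivAt t h1).sub (hQ x t)).hasDerivWithinAt
  have hb : ∀ t ∈ Set.Ico (0 : ℝ) 1, ‖(F' (t • x) - K (t • x)) x‖ ≤ ε * ‖x‖ ^ (n + 1) :=
    fun t ht => by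
    have h1 := (hball (hin t ⟨ht.1, ht.2.le⟩)).2
    have h2 : ‖t • x‖ ≤ ‖x‖ := by
      rw [norm_smul, Real.norm_of_nonneg ht.1]
      exact mul_le_of_le_one_left (norm_nonneg _) ht.2.le
    have h3 : ‖t • x‖ ^ n ≤ ‖x‖ ^ n := pow_le_pow_left₀ (norm_nonneg _) h2 n
    rw [Real.norm_of_nonneg (by positivity : (0 : ℝ) ≤ ‖t • x‖ ^ n)] at h1
    calc _ ≤ ‖F' (t • x) - K (t • x)‖ * ‖x‖ := ContinuousLinearMap.le_opNorm _ _
      _ ≤ ε * ‖x‖ ^ n * ‖x‖ := by gcongr; exact h1.trans (by gcongr)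
      _ = ε * ‖x‖ ^ (n + 1) := by ring
  have := norm_image_sub_le_of_norm_deriv_le_segment' hder hb 1 (by simp)
  rw [Real.norm_of_nonneg (by positivity : (0 : ℝ) ≤ ‖x‖ ^ (n + 1))]
  simpa [h0] using this

/-- Second-order expansion of the derivative, and third-order expansion of the map itself, at a
point where the map is three times differentiable. -/
lemma taylor_of_differentiableAt_three {g : E → W} {x : E}
    (h0 : ∀ᶠ y in 𝓝 x, DifferentiableAt ℝ g y)
    (h1 : ∀ᶠ y in 𝓝 x, DifferentiableAt ℝ (fderiv ℝ g) y)
    (h2 : DifferentiableAt ℝ (fderiv ℝ (fderiv ℝ g)) x) :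
    ((fun y => fderiv ℝ g (x + y) - (fderiv ℝ g x + fderiv ℝ (fderiv ℝ g) x y
        + (1 / 2 : ℝ) • fderiv ℝ (fderiv ℝ (fderiv ℝ g)) x y y)) =o[𝓝 0] fun y => ‖y‖ ^ 2) ∧
    ((fun y => g (x + y) - (g x + fderiv ℝ g x y + (1 / 2 : ℝ) • fderiv ℝ (fderiv ℝ g) x y y
        + (1 / 6 : ℝ) • fderiv ℝ (fderiv ℝ (fderiv ℝ g)) x y y y)) =o[𝓝 0] fun y => ‖y‖ ^ 3) := by
  set H := fderiv ℝ g x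
  set B := fderiv ℝ (fderiv ℝ g) x with hB
  set C := fderiv ℝ (fderiv ℝ (fderiv ℝ g)) x with hC
  have ht : Tendsto (fun y : E => x + y) (𝓝 0) (𝓝 x) := by
    have : ContinuousAt (fun y : E => x + y) 0 := by fun_prop
    simpa [ContinuousAt] using this
  have e2 : (fun y => fderiv ℝ (fderiv ℝ g) (x + y) - (B + C y)) =o[𝓝 0] fun y => ‖y‖ ^ 1 := by
    have := h2.hasFDerivAt
    simpa [sub_sub] using ((hasFDerivAt_iff_isLittleO_nhds_zero (𝕜 := ℝ)
      (f := fderiv ℝ (fderiv ℝ g)) (f' := C) (x := x)).1 this).norm_right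
  have e1 : (fun y => fderiv ℝ g (x + y) - (H + B y + (1 / 2 : ℝ) • C y y))
      =o[𝓝 0] fun y => ‖y‖ ^ 2 := by
    refine isLittleO_sub_of_fderiv_isLittleO (F := fun y => fderiv ℝ g (x + y))
      (Q := fun y => H + B y + (1 / 2 : ℝ) • C y y) ?_ e2 ?_ (by simp [H])
    · filter_upwards [ht.eventually h1] with y hy
      exact (hasFDerivAt_comp_add_left x).2 hy.hasFDerivAt
    · intro y t
      have ha : HasDerivAt (fun t : ℝ => H + t • B y + (t ^ 2 / 2) • C y y)
          (B y + t • C y y) t := by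
        have := (((hasDerivAt_id t).smul_const (B y)).const_add H).add
          ((((hasDerivAt_id t).pow 2).div_const 2).smul_const (C y y))
        refine this.congr_deriv ?_
        simp
      refine (ha.congr_deriv (by simp)).congr_of_eventuallyEq (.of_forall fun t => ?_)
      simp only [map_smul, smul_apply, smul_smul]
      congr 2
      ring
  refine ⟨e1, ?_⟩
  refine isLittleO_sub_of_fderiv_isLittleO (F := fun y => g (x + y))
    (Q := fun y => g x + H y + (1 / 2 : ℝ) • B y y + (1 / 6 : ℝ) • C y y y) ?_ e1 ?_ (by simp)
  · filter_upwards [ht.eventually h0] with y hy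
    exact (hasFDerivAt_comp_add_left x).2 hy.hasFDerivAt
  · intro y t
    have ha : HasDerivAt (fun t : ℝ => g x + t • H y + (t ^ 2 / 2) • B y y + (t ^ 3 / 6) • C y y y)
        (H y + t • B y y + (t ^ 2 / 2) • C y y y) t := by
      have := ((((hasDerivAt_id t).smul_const (H y)).const_add (g x)).add
        ((((hasDerivAt_id t).pow 2).div_const 2).smul_const (B y y))).add
        ((((hasDerivAt_id t).pow 3).div_const 6).smul_const (C y y y))
      refine this.congr_deriv ?_
      simp only [id, one_smul, Nat.cast_ofNat]
      congr 2
      · simp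
      · ring
    refine (ha.congr_deriv ?_).congr_of_eventuallyEq (.of_forall fun t => ?_)
    · simp only [map_smul, smul_apply, add_apply, smul_smul]
      congr 2
      ring
    · simp only [map_smul, smul_apply, smul_smul]
      module

end Taylor

/-! ### The gradient of a four times differentiable function -/

section Gradient

variable {d : ℕ}

lemma differentiableAt_iteratedFDeriv_succ_iff {E F : Type*} [NormedAddCommGroup E]
    [NormedSpace ℝ E] [NormedAddCommGroup F] [NormedSpace ℝ F] {f : E → F} {n : ℕ} {x : E} :
    DifferentiableAt ℝ (iteratedFDeriv ℝ (n + 1) f) x ↔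
      DifferentiableAt ℝ (iteratedFDeriv ℝ n (fderiv ℝ f)) x := by
  have : iteratedFDeriv ℝ (n + 1) f = (continuousMultilinearCurryRightEquiv' ℝ n E F).symm ∘
      iteratedFDeriv ℝ n (fderiv ℝ f) := funext fun y => iteratedFDeriv_succ_eq_comp_right
  rw [this]
  exact LinearIsometryEquiv.comp_differentiableAt_iff (𝕜 := ℝ)
    (E := ContinuousMultilinearMap ℝ (fun _ : Fin n => E) (E →L[ℝ] F))
    (F := ContinuousMultilinearMap ℝ (fun _ : Fin (n + 1) => E) F)
    (iso := (continuousMultilinearCurryRightEquiv' ℝ n E F).symm)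
    (f := iteratedFDeriv ℝ n (fderiv ℝ f)) (x := x)

lemma differentiableAt_iteratedFDeriv_zero_iff {E F : Type*} [NormedAddCommGroup E]
    [NormedSpace ℝ E] [NormedAddCommGroup F] [NormedSpace ℝ F] {f : E → F} {x : E} :
    DifferentiableAt ℝ (iteratedFDeriv ℝ 0 f) x ↔ DifferentiableAt ℝ f x := by
  rw [iteratedFDeriv_zero_eq_comp]
  exact (continuousMultilinearCurryFin0 ℝ E F).symm.comp_differentiableAt_iff

/-- Iterated Fréchet derivatives, as curried continuous linear maps instead of multilinear ones. -/
lemma TimesDifferentiableAt.fderiv_four {L : RSpace d → ℝ} {x : RSpace d}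
    (h : TimesDifferentiableAt 4 L x) :
    (∀ᶠ y in 𝓝 x, DifferentiableAt ℝ L y) ∧ (∀ᶠ y in 𝓝 x, DifferentiableAt ℝ (fderiv ℝ L) y) ∧
    (∀ᶠ y in 𝓝 x, DifferentiableAt ℝ (fderiv ℝ (fderiv ℝ L)) y) ∧
    DifferentiableAt ℝ (fderiv ℝ (fderiv ℝ (fderiv ℝ L))) x := by
  have h0 := h.1 0 (by norm_num)
  have h1 := h.1 1 (by norm_num)
  have h2 := h.1 2 (by norm_num)
  have h3 := h.2 3 (by norm_num)
  simp only [differentiableAt_iteratedFDeriv_succ_iff,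
    differentiableAt_iteratedFDeriv_zero_iff] at h0 h1 h2 h3
  exact ⟨h0, h1, h2, h3⟩

/-- The Riesz isomorphism from the dual space onto `ℝ^d`, as a real continuous linear map. -/
noncomputable def rieszMap (d : ℕ) : (RSpace d →L[ℝ] ℝ) →L[ℝ] RSpace d :=
  LinearMap.toContinuousLinearMap
    { toFun := fun f => (InnerProductSpace.toDual ℝ (RSpace d)).symm f
      map_add' := fun f g => map_add _ f g
      map_smul' := fun c f => by simp }

lemma gradient_eq_rieszMap_comp (L : RSpace d → ℝ) :
    gradient L = fun x => rieszMap d (fderiv ℝ L x) := rfl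

@[simp]
lemma inner_rieszMap (f : RSpace d →L[ℝ] ℝ) (x : RSpace d) :
    inner ℝ (rieszMap d f) x = f x :=
  InnerProductSpace.toDual_symm_apply

end Gradient

section GradientJet

variable {d : ℕ}

lemma eventually_fderiv_clm_comp {E V W : Type*} [NormedAddCommGroup E] [NormedSpace ℝ E]
    [NormedAddCommGroup V] [NormedSpace ℝ V] [NormedAddCommGroup W] [NormedSpace ℝ W]
    (R : V →L[ℝ] W) {F : E → V} {G : E → W} {x : E} (hG : G =ᶠ[𝓝 x] fun y => R (F y))
    (hF : ∀ᶠ y in 𝓝 x, DifferentiableAt ℝ F y) :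
    (∀ᶠ y in 𝓝 x, DifferentiableAt ℝ G y) ∧
      fderiv ℝ G =ᶠ[𝓝 x] fun y => ContinuousLinearMap.compL ℝ E V W R (fderiv ℝ F y) := by
  have h : ∀ᶠ y in 𝓝 x, HasFDerivAt G (R ∘L fderiv ℝ F y) y := by
    filter_upwards [hG.eventually_nhds, hF] with y hy hFy
    exact (R.hasFDerivAt.comp y hFy.hasFDerivAt).congr_of_eventuallyEq hy
  exact ⟨h.mono fun y hy => hy.differentiableAt, h.mono fun y hy => hy.fderiv⟩

/-- Post-composition with a continuous linear map commutes with the first three derivatives. -/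
lemma fderiv_three_clm_comp {E V W : Type*} [NormedAddCommGroup E] [NormedSpace ℝ E]
    [NormedAddCommGroup V] [NormedSpace ℝ V] [NormedAddCommGroup W] [NormedSpace ℝ W]
    (R : V →L[ℝ] W) {F : E → V} {x : E}
    (h1 : ∀ᶠ y in 𝓝 x, DifferentiableAt ℝ F y)
    (h2 : ∀ᶠ y in 𝓝 x, DifferentiableAt ℝ (fderiv ℝ F) y)
    (h3 : DifferentiableAt ℝ (fderiv ℝ (fderiv ℝ F)) x) :
    (∀ᶠ y in 𝓝 x, DifferentiableAt ℝ (fun z => R (F z)) y) ∧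
    (∀ᶠ y in 𝓝 x, DifferentiableAt ℝ (fderiv ℝ (fun z => R (F z))) y) ∧
    DifferentiableAt ℝ (fderiv ℝ (fderiv ℝ (fun z => R (F z)))) x ∧
    (∀ᶠ y in 𝓝 x, ∀ a, fderiv ℝ (fun z => R (F z)) y a = R (fderiv ℝ F y a)) ∧
    (∀ a b, fderiv ℝ (fderiv ℝ (fun z => R (F z))) x a b = R (fderiv ℝ (fderiv ℝ F) x a b)) ∧
    (∀ a b c, fderiv ℝ (fderiv ℝ (fderiv ℝ (fun z => R (F z)))) x a b c =
      R (fderiv ℝ (fderiv ℝ (fderiv ℝ F)) x a b c)) := by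
  obtain ⟨g1, e1⟩ := eventually_fderiv_clm_comp R (G := fun z => R (F z)) EventuallyEq.rfl h1
  obtain ⟨g2, e2⟩ := eventually_fderiv_clm_comp _ e1 h2
  have g3 := ((ContinuousLinearMap.compL ℝ E _ _
    (ContinuousLinearMap.compL ℝ E V W R)).hasFDerivAt.comp x
      h3.hasFDerivAt).congr_of_eventuallyEq e2
  refine ⟨g1, g2, g3.differentiableAt, ?_, fun a b => ?_, fun a b c => ?_⟩
  · filter_upwards [e1] with y hy a
    simp [hy]
  · simp [e2.self_of_nhds]
  · simp [g3.fderiv]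

/-- The gradient of a four times differentiable function is three times differentiable, and its
derivatives represent those of the function through the inner product. -/
lemma TimesDifferentiableAt.gradient_three {L : RSpace d → ℝ} {x : RSpace d}
    (h : TimesDifferentiableAt 4 L x) :
    (∀ᶠ y in 𝓝 x, DifferentiableAt ℝ (gradient L) y) ∧
    (∀ᶠ y in 𝓝 x, DifferentiableAt ℝ (fderiv ℝ (gradient L)) y) ∧
    DifferentiableAt ℝ (fderiv ℝ (fderiv ℝ (gradient L))) x ∧
    (∀ᶠ y in 𝓝 x, ∀ a b, inner ℝ (fderiv ℝ (gradient L) y a) b = fderiv ℝ (fderiv ℝ L) y a b) ∧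
    (∀ a b c, inner ℝ (fderiv ℝ (fderiv ℝ (gradient L)) x a b) c =
      fderiv ℝ (fderiv ℝ (fderiv ℝ L)) x a b c) ∧
    (∀ a b c e, inner ℝ (fderiv ℝ (fderiv ℝ (fderiv ℝ (gradient L))) x a b c) e =
      fderiv ℝ (fderiv ℝ (fderiv ℝ (fderiv ℝ L))) x a b c e) := by
  obtain ⟨-, h1, h2, h3⟩ := h.fderiv_four
  obtain ⟨g1, g2, g3, e1, e2, e3⟩ := fderiv_three_clm_comp (rieszMap d) h1 h2 h3
  rw [gradient_eq_rieszMap_comp]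
  refine ⟨g1, g2, g3, ?_, fun a b c => ?_, fun a b c e => ?_⟩
  · filter_upwards [e1] with y hy a b
    rw [hy, inner_rieszMap]
  · rw [e2, inner_rieszMap]
  · rw [e3, inner_rieszMap]

lemma TimesDifferentiableAt.gradient_symm {L : RSpace d → ℝ} {x : RSpace d}
    (h : TimesDifferentiableAt 4 L x) :
    (∀ a b, inner ℝ (fderiv ℝ (gradient L) x a) b = inner ℝ a (fderiv ℝ (gradient L) x b)) ∧
    (∀ a b c, inner ℝ (fderiv ℝ (fderiv ℝ (gradient L)) x a b) c =
      inner ℝ b (fderiv ℝ (fderiv ℝ (gradient L)) x a c)) ∧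
    (∀ a b, fderiv ℝ (fderiv ℝ (gradient L)) x a b = fderiv ℝ (fderiv ℝ (gradient L)) x b a) := by
  obtain ⟨h0, h1, h2, h3⟩ := h.fderiv_four
  obtain ⟨g1, g2, -, e1, e2, -⟩ := h.gradient_three
  have hs : ∀ᶠ y in 𝓝 x, ∀ a b, fderiv ℝ (fderiv ℝ L) y a b = fderiv ℝ (fderiv ℝ L) y b a := by
    filter_upwards [h0.eventually_nhds, h1] with y hy hy1 a b
    exact second_derivative_symmetric_of_eventually (hy.mono fun z hz => hz.hasFDerivAt)
      hy1.hasFDerivAt a b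
  refine ⟨fun a b => ?_, fun a b c => ?_, fun a b => ?_⟩
  · rw [real_inner_comm _ a, e1.self_of_nhds, e1.self_of_nhds, hs.self_of_nhds]
  · rw [real_inner_comm _ b, e2, e2]
    have hD := h2.self_of_nhds.hasFDerivAt
    have k : ∀ b c, HasFDerivAt (fun y => fderiv ℝ (fderiv ℝ L) y b c)
        ((fderiv ℝ (fderiv ℝ (fderiv ℝ L)) x).flip b |>.flip c) x := fun b c => by
      have := (hD.clm_apply (hasFDerivAt_const b x)).clm_apply (hasFDerivAt_const c x)
      refine this.congr_fderiv ?_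
      ext a
      simp
    have := (k b c).unique ((k c b).congr_of_eventuallyEq (hs.mono fun y hy => hy b c))
    simpa using congrArg (fun f => f a) this
  · exact second_derivative_symmetric_of_eventually (g1.mono fun z hz => hz.hasFDerivAt)
      g2.self_of_nhds.hasFDerivAt a b

lemma iteratedFDeriv_three_apply (L : RSpace d → ℝ) (x : RSpace d) (m : Fin 3 → RSpace d) :
    iteratedFDeriv ℝ 3 L x m = fderiv ℝ (fderiv ℝ (fderiv ℝ L)) x (m 0) (m 1) (m 2) := by
  simp only [iteratedFDeriv_succ_apply_right, iteratedFDeriv_zero_apply]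
  rfl

lemma iteratedFDeriv_four_apply (L : RSpace d → ℝ) (x : RSpace d) (m : Fin 4 → RSpace d) :
    iteratedFDeriv ℝ 4 L x m =
      fderiv ℝ (fderiv ℝ (fderiv ℝ (fderiv ℝ L))) x (m 0) (m 1) (m 2) (m 3) := by
  simp only [iteratedFDeriv_succ_apply_right, iteratedFDeriv_zero_apply]
  rfl

/-- The gradient of the cubic form of a symmetric trilinear form is three times its polarisation. -/
lemma TimesDifferentiableAt.gradient_cubic {L : RSpace d → ℝ} {x : RSpace d}
    (h : TimesDifferentiableAt 4 L x) (v : RSpace d) :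
    gradient (fun w => iteratedFDeriv ℝ 3 L x (fun _ => w)) v =
      (3 : ℝ) • fderiv ℝ (fderiv ℝ (gradient L)) x v v := by
  obtain ⟨-, -, -, -, e2, -⟩ := h.gradient_three
  obtain ⟨-, hB, hB'⟩ := h.gradient_symm
  set B := fderiv ℝ (fderiv ℝ (gradient L)) x
  have hD : HasFDerivAt (fun w => inner ℝ (B w w) w) ((3 : ℝ) • innerSL ℝ (B v v)) v := by
    have := ((B.hasFDerivAt (x := v)).clm_apply (hasFDerivAt_id v)).inner ℝ (hasFDerivAt_id v)
    refine this.congr_fderiv ?_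
    ext a
    simp [inner_add_left, hB' a v, hB v a v, real_inner_comm _ a]
    ring
  have : (fun w => iteratedFDeriv ℝ 3 L x (fun _ => w)) = fun w => inner ℝ (B w w) w :=
    funext fun w => by rw [iteratedFDeriv_three_apply, e2]
  rw [this]
  refine HasGradientAt.gradient ?_
  rw [hasGradientAt_iff_hasFDerivAt]
  refine hD.congr_fderiv ?_
  ext a
  simp

end GradientJet

/-! ### Asymptotic bookkeeping -/

section Bookkeeping

open Asymptotics

variable {ι E F : Type*} [NormedAddCommGroup E] [NormedSpace ℝ E]
  [NormedAddCommGroup F] [NormedSpace ℝ F] {l : Filter ι}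

lemma clm_apply_isBigO {T : ι → E →L[ℝ] F} {f : ι → E} {α β : ι → ℝ}
    (hT : T =O[l] α) (hf : f =O[l] β) : (fun i => T i (f i)) =O[l] fun i => α i * β i :=
  (IsBigO.of_norm_le fun i => by simpa using (T i).le_opNorm (f i)).trans
    (hT.norm_left.mul hf.norm_left)

lemma clm_apply_isLittleO {T : ι → E →L[ℝ] F} {f : ι → E} {α β : ι → ℝ}
    (hT : T =o[l] α) (hf : f =O[l] β) : (fun i => T i (f i)) =o[l] fun i => α i * β i :=
  (IsBigO.of_norm_le fun i => by simpa using (T i).le_opNorm (f i)).trans_isLittleO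
    (hT.norm_left.mul_isBigO hf.norm_left)

lemma const_clm_apply_isBigO (T : E →L[ℝ] F) {f : ι → E} {β : ι → ℝ}
    (hf : f =O[l] β) : (fun i => T (f i)) =O[l] β :=
  (T.isBigO_comp f l).trans hf

lemma const_clm_apply_isLittleO (T : E →L[ℝ] F) {f : ι → E} {β : ι → ℝ}
    (hf : f =o[l] β) : (fun i => T (f i)) =o[l] β :=
  (T.isBigO_comp f l).trans_isLittleO hf

lemma smul_const_isBigO (x : E) {f β : ι → ℝ} (hf : f =O[l] β) :
    (fun i => f i • x) =O[l] β := by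
  refine (IsBigO.of_bound ‖x‖ (.of_forall fun i => ?_)).trans hf
  rw [norm_smul, mul_comm]

lemma smul_const_isLittleO (x : E) {f β : ι → ℝ} (hf : f =o[l] β) :
    (fun i => f i • x) =o[l] β := by
  refine (IsBigO.of_bound ‖x‖ (.of_forall fun i => ?_)).trans_isLittleO hf
  rw [norm_smul, mul_comm]

lemma pow_isLittleO_pow {a : ι → ℝ} (ha : Tendsto a l (𝓝 0)) {m n : ℕ} (h : m < n) :
    (fun i => a i ^ n) =o[l] fun i => a i ^ m :=
  (isLittleO_pow_pow h).comp_tendsto ha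

lemma pow_isBigO_pow {a : ι → ℝ} (ha : Tendsto a l (𝓝 0)) {m n : ℕ} (h : m ≤ n) :
    (fun i => a i ^ n) =O[l] fun i => a i ^ m := by
  rcases h.eq_or_lt with rfl | h
  · exact isBigO_refl _ _
  · exact (pow_isLittleO_pow ha h).isBigO

/-- Absorption of a superlinear error: if `f = O(α + ‖f‖ β)` with `β → 0`, then `f = O(α)`. -/
lemma isBigO_of_norm_le_add_mul {ι E : Type*} [NormedAddCommGroup E] {l : Filter ι} {f : ι → E}
    {α β : ι → ℝ} {K : ℝ}
    (hβ : Tendsto β l (𝓝 0)) (h : ∀ᶠ i in l, ‖f i‖ ≤ K * ‖α i‖ + β i * ‖f i‖) :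
    f =O[l] α := by
  refine IsBigO.of_bound (2 * K) ?_
  filter_upwards [h, hβ.eventually (gt_mem_nhds (by norm_num : (0 : ℝ) < 1 / 2))] with i hi hb
  nlinarith [norm_nonneg (f i)]

end Bookkeeping

/-! ### Two-cycles of a gradient-like map at a flip bifurcation -/

section FlipJet

open Asymptotics

variable {E : Type*} [NormedAddCommGroup E] [InnerProductSpace ℝ E]

/-- The local data of a vector field `g` on `E` at the equilibrium `0` when the map
`x ↦ x - (2 / c₀) • g x` undergoes a flip: `H`, `B`, `C` are the first three derivatives of `g` at
`0`, `v` is the unit critical direction, on which `H` acts as `c₀`, and `p` solves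
`H p = B v v`. Symmetry of `H` holds because `g` is a gradient. -/
structure IsFlipJet (g : E → E) (c₀ : ℝ) (v p : E) (H : E →L[ℝ] E) (B : E →L[ℝ] E →L[ℝ] E)
    (C : E →L[ℝ] E →L[ℝ] E →L[ℝ] E) : Prop where
  differentiable : ∀ᶠ y in 𝓝 0, DifferentiableAt ℝ g y
  strict : HasStrictFDerivAt g H 0
  taylor : (fun y => g y - (H y + (1 / 2 : ℝ) • B y y + (1 / 6 : ℝ) • C y y y))
    =o[𝓝 0] fun y => ‖y‖ ^ 3
  taylor_fderiv : (fun y => fderiv ℝ g y - (H + B y + (1 / 2 : ℝ) • C y y))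
    =o[𝓝 0] fun y => ‖y‖ ^ 2
  pos : 0 < c₀
  norm_v : ‖v‖ = 1
  H_v : H v = c₀ • v
  H_p : H p = B v v
  H_symm : ∀ x y, inner ℝ (H x) y = inner ℝ x (H y)
  B_comm : ∀ x y, B x y = B y x
  bounded_below : ∃ k > 0, ∀ x, ‖x‖ ≤ k * ‖H x‖
  contract : ∃ ρ, 0 ≤ ρ ∧ ρ < 1 ∧ ∀ w, inner ℝ v w = 0 → ‖w - (2 / c₀) • H w‖ ≤ ρ * ‖w‖

/-- The coefficient of the cubic term in the bifurcation equation of the flip. -/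
noncomputable def flipCoeff (v p : E) (B : E →L[ℝ] E →L[ℝ] E) (C : E →L[ℝ] E →L[ℝ] E →L[ℝ] E) :
    ℝ :=
  1 / 2 * inner ℝ v (B v p) - 1 / 6 * inner ℝ v (C v v v)

/-- A family of approximate two-cycles `m ± s` of `x ↦ x - (2 / c) • g x`, shrinking to `0` while
`c → c₀`. The cycle equations are `g (m + s) + g (m - s) = 0` and
`g (m + s) - g (m - s) = 2 c s`; the second one is allowed to fail along `v`, by the defect `e`. -/
structure IsNearCycle {ι : Type*} (l : Filter ι) (g : E → E) (c₀ : ℝ) (v : E) (m s : ι → E)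
    (c e : ι → ℝ) : Prop where
  tendsto_m : Tendsto m l (𝓝 0)
  tendsto_s : Tendsto s l (𝓝 0)
  tendsto_c : Tendsto c l (𝓝 c₀)
  sum_eq : ∀ᶠ i in l, g (m i + s i) + g (m i - s i) = 0
  diff_eq : ∀ᶠ i in l, g (m i + s i) - g (m i - s i) - (2 * c i) • s i = e i • v

variable {ι : Type*} {l : Filter ι} {g : E → E} {c₀ : ℝ} {v p : E} {H : E →L[ℝ] E}
  {B : E →L[ℝ] E →L[ℝ] E} {C : E →L[ℝ] E →L[ℝ] E →L[ℝ] E} {m s : ι → E} {c e : ι → ℝ}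

namespace IsFlipJet

lemma isBigO_sub_linear (hJ : IsFlipJet g c₀ v p H B C) :
    (fun y => g y - H y) =O[𝓝 0] fun y => ‖y‖ ^ 2 := by
  have hn : Tendsto (fun y : E => ‖y‖) (𝓝 0) (𝓝 0) := tendsto_norm_zero
  have hid : (fun y : E => y) =O[𝓝 0] fun y => ‖y‖ := (isBigO_refl _ _).norm_right
  have hB := clm_apply_isBigO (const_clm_apply_isBigO B hid) hid
  have hC := clm_apply_isBigO (clm_apply_isBigO (const_clm_apply_isBigO C hid) hid) hid
  have h3 : (fun y : E => ‖y‖ ^ 3) =O[𝓝 0] fun y => ‖y‖ ^ 2 := pow_isBigO_pow hn (by norm_num)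
  have := ((hJ.taylor.isBigO.trans h3).add ((hB.const_smul_left (1 / 2 : ℝ)).congr_right
    (g₂ := fun y => ‖y‖ ^ 2) fun y => by ring)).add (((hC.const_smul_left (1 / 6 : ℝ)).congr_right
    (g₂ := fun y => ‖y‖ ^ 3) fun y => by ring).trans h3)
  refine this.congr_left fun y => ?_
  simp only [Pi.smul_apply]
  abel

end IsFlipJet

namespace IsNearCycle

/-- The midpoint of a near-cycle is of second order in its half-width. -/
lemma isBigO_midpoint (hJ : IsFlipJet g c₀ v p H B C) (hN : IsNearCycle l g c₀ v m s c e) :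
    m =O[l] fun i => ‖s i‖ ^ 2 := by
  obtain ⟨k, hk, hkH⟩ := hJ.bounded_below
  have hp : Tendsto (fun i => m i + s i) l (𝓝 0) := by simpa using hN.tendsto_m.add hN.tendsto_s
  have hq : Tendsto (fun i => m i - s i) l (𝓝 0) := by simpa using hN.tendsto_m.sub hN.tendsto_s
  obtain ⟨K, hK0, hK⟩ := hJ.isBigO_sub_linear.exists_pos
  have hβ : Tendsto (fun i => 2 * (k * K) * ‖m i‖) l (𝓝 0) := by
    simpa using hN.tendsto_m.norm.const_mul (2 * (k * K))
  refine isBigO_of_norm_le_add_mul (K := 2 * (k * K)) hβ ?_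
  filter_upwards [hN.sum_eq, hp.eventually hK.bound, hq.eventually hK.bound] with i h1 h2 h3
  have e1 : (2 : ℝ) • H (m i) =
      -((g (m i + s i) - H (m i + s i)) + (g (m i - s i) - H (m i - s i))) := by
    have : (g (m i + s i) - H (m i + s i)) + (g (m i - s i) - H (m i - s i)) =
      (g (m i + s i) + g (m i - s i)) - (2 : ℝ) • H (m i) := by
        rw [map_add, map_sub]; module
    rw [this, h1]; simp
  have e2 : 2 * ‖H (m i)‖ ≤ K * ‖m i + s i‖ ^ 2 + K * ‖m i - s i‖ ^ 2 := by
    have := norm_add_le (g (m i + s i) - H (m i + s i)) (g (m i - s i) - H (m i - s i))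
    rw [← norm_neg, ← e1, norm_smul] at this
    simp only [norm_pow, norm_norm, Real.norm_ofNat] at this h2 h3
    linarith
  have e3 : ‖m i + s i‖ ^ 2 + ‖m i - s i‖ ^ 2 = 2 * (‖m i‖ ^ 2 + ‖s i‖ ^ 2) := by
    have := parallelogram_law_with_norm ℝ (m i) (s i)
    nlinarith
  have e4 : ‖H (m i)‖ ≤ K * (‖m i‖ ^ 2 + ‖s i‖ ^ 2) := by nlinarith
  have e5 := (hkH (m i)).trans (mul_le_mul_of_nonneg_left e4 hk.le)
  have : 0 ≤ k * K * (‖m i‖ ^ 2 + ‖s i‖ ^ 2) := by positivity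
  simp only [norm_pow, norm_norm]
  nlinarith

/-- The two cycle equations, expanded to third order. -/
lemma cycle_expansion (hJ : IsFlipJet g c₀ v p H B C) (hN : IsNearCycle l g c₀ v m s c e) :
    (fun i => (2 : ℝ) • H (m i) + B (s i) (s i)) =O[l] (fun i => ‖s i‖ ^ 3) ∧
    (fun i => e i • v - ((2 : ℝ) • (H (s i) - c i • s i) + (2 : ℝ) • B (s i) (m i)
      + (1 / 3 : ℝ) • C (s i) (s i) (s i))) =o[l] (fun i => ‖s i‖ ^ 3) := by
  have hσ : Tendsto (fun i => ‖s i‖) l (𝓝 0) := by simpa using hN.tendsto_s.norm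
  have hs : s =O[l] fun i => ‖s i‖ := (isBigO_refl _ _).norm_right
  have hm2 := hN.isBigO_midpoint hJ
  have hm : m =O[l] fun i => ‖s i‖ :=
    hm2.trans ((pow_isBigO_pow hσ one_le_two).congr_right fun i => pow_one _)
  have hp : Tendsto (fun i => m i + s i) l (𝓝 0) := by simpa using hN.tendsto_m.add hN.tendsto_s
  have hq : Tendsto (fun i => m i - s i) l (𝓝 0) := by simpa using hN.tendsto_m.sub hN.tendsto_s
  have rp := (hJ.taylor.comp_tendsto hp).trans_isBigO ((hm.add hs).norm_left.pow 3)
  have rq := (hJ.taylor.comp_tendsto hq).trans_isBigO ((hm.sub hs).norm_left.pow 3)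
  have cub : ∀ {x y z : ι → E}, x =O[l] (fun i => ‖s i‖) → y =O[l] (fun i => ‖s i‖) →
      z =O[l] (fun i => ‖s i‖) → (fun i => C (x i) (y i) (z i)) =O[l] fun i => ‖s i‖ ^ 3 :=
    fun hx hy hz => (clm_apply_isBigO (clm_apply_isBigO (const_clm_apply_isBigO C hx) hy)
      hz).congr_right fun i => by ring
  constructor
  · have hBm : (fun i => B (m i) (m i)) =O[l] fun i => ‖s i‖ ^ 3 :=
      (clm_apply_isBigO (const_clm_apply_isBigO B hm) hm2).congr_right fun i => by ring
    have hCp := cub (hm.add hs) (hm.add hs) (hm.add hs)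
    have hCq := cub (hm.sub hs) (hm.sub hs) (hm.sub hs)
    have := ((hBm.add ((hCp.add hCq).const_smul_left (1 / 6 : ℝ))).add
      (rp.isBigO.add rq.isBigO)).neg_left
    refine this.congr' ?_ .rfl
    filter_upwards [hN.sum_eq] with i hi
    simp only [Pi.smul_apply, Function.comp_apply]
    rw [eq_neg_of_add_eq_zero_left hi]
    simp only [map_add, map_sub, add_apply, sub_apply]
    module
  · have hCmm : (fun i => C (m i) (m i) (s i)) =o[l] fun i => ‖s i‖ ^ 3 :=
      ((clm_apply_isBigO (clm_apply_isBigO (const_clm_apply_isBigO C hm2) hm2) hs).congr_right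
        (g₂ := fun i => ‖s i‖ ^ 5) fun i => by ring).trans_isLittleO
        (pow_isLittleO_pow hσ (by norm_num))
    have hCms : (fun i => C (m i) (s i) (m i)) =o[l] fun i => ‖s i‖ ^ 3 :=
      ((clm_apply_isBigO (clm_apply_isBigO (const_clm_apply_isBigO C hm2) hs) hm2).congr_right
        (g₂ := fun i => ‖s i‖ ^ 5) fun i => by ring).trans_isLittleO
        (pow_isLittleO_pow hσ (by norm_num))
    have hCsm : (fun i => C (s i) (m i) (m i)) =o[l] fun i => ‖s i‖ ^ 3 :=
      ((clm_apply_isBigO (clm_apply_isBigO (const_clm_apply_isBigO C hs) hm2) hm2).congr_right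
        (g₂ := fun i => ‖s i‖ ^ 5) fun i => by ring).trans_isLittleO
        (pow_isLittleO_pow hσ (by norm_num))
    have := (((hCmm.add hCms).add hCsm).const_smul_left (1 / 3 : ℝ)).add (rp.sub rq)
    refine this.congr' ?_ .rfl
    filter_upwards [hN.diff_eq] with i hi
    simp only [Pi.smul_apply, Function.comp_apply]
    rw [← hi]
    simp only [map_add, map_sub, add_apply, sub_apply, hJ.B_comm (m i) (s i)]
    module

/-- Transversally to `v`, the operator `H - c` is bounded below, uniformly for `c` near `c₀`. -/
lemma isBigO_transverse (hJ : IsFlipJet g c₀ v p H B C) {w : ι → E}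
    (hc : Tendsto c l (𝓝 c₀)) (hw : ∀ i, inner ℝ v (w i) = 0) :
    w =O[l] fun i => H (w i) - c i • w i := by
  obtain ⟨ρ, hρ0, hρ1, hρ⟩ := hJ.contract
  have hc0 := hJ.pos
  have hb : Tendsto (fun i => |2 - 2 / c₀ * c i|) l (𝓝 0) := by
    have : Tendsto (fun i => |2 - 2 / c₀ * c i|) l (𝓝 |2 - 2 / c₀ * c₀|) :=
      ((hc.const_mul _).const_sub _).abs
    rwa [div_mul_cancel₀ _ hc0.ne', sub_self, abs_zero] at this
  refine IsBigO.of_bound (2 / c₀ * (2 / (1 - ρ))) ?_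
  filter_upwards [hb.eventually (gt_mem_nhds (by linarith : (0 : ℝ) < (1 - ρ) / 2))] with i hi
  have e1 : w i = -((2 / c₀) • (H (w i) - c i • w i)) - (w i - (2 / c₀) • H (w i))
      + (2 - 2 / c₀ * c i) • w i := by module
  have e2 : ‖w i‖ ≤ 2 / c₀ * ‖H (w i) - c i • w i‖ + ρ * ‖w i‖ + (1 - ρ) / 2 * ‖w i‖ := by
    calc ‖w i‖ = _ := congrArg norm e1
      _ ≤ ‖-((2 / c₀) • (H (w i) - c i • w i))‖ + ‖w i - (2 / c₀) • H (w i)‖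
          + ‖(2 - 2 / c₀ * c i) • w i‖ :=
        (norm_add_le _ _).trans (add_le_add_left (norm_sub_le _ _) _)
      _ ≤ _ := by
        rw [norm_neg, norm_smul, norm_smul, Real.norm_of_nonneg (by positivity : 0 ≤ 2 / c₀),
          Real.norm_eq_abs]
        gcongr
        exact hρ _ (hw i)
  rw [mul_assoc, mul_comm, mul_assoc, div_mul_eq_mul_div, le_div_iff₀ (by linarith)]
  nlinarith

/-- Reduction to one dimension: near-cycles have half-width `s = a v + O(a³)` with `a = ⟪v, s⟫`,
midpoint `-(a² / 2) p + O(a³)`, and their defect is governed by the bifurcation equation. -/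
lemma reduction (hJ : IsFlipJet g c₀ v p H B C) (hN : IsNearCycle l g c₀ v m s c e) :
    (s =O[l] fun i => inner ℝ v (s i)) ∧
    (fun i => s i - inner ℝ v (s i) • v) =O[l] (fun i => inner ℝ v (s i) ^ 3) ∧
    (fun i => m i + (inner ℝ v (s i) ^ 2 / 2) • p) =O[l] (fun i => inner ℝ v (s i) ^ 3) ∧
    (fun i => e i - (2 * inner ℝ v (s i) * (c₀ - c i)
      - 2 * flipCoeff v p B C * inner ℝ v (s i) ^ 3)) =o[l] (fun i => inner ℝ v (s i) ^ 3) := by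
  obtain ⟨h1, h2⟩ := hN.cycle_expansion hJ
  have hm2 := hN.isBigO_midpoint hJ
  have hvv : inner ℝ v v = (1 : ℝ) := by rw [real_inner_self_eq_norm_sq, hJ.norm_v, one_pow]
  set a : ι → ℝ := fun i => inner ℝ v (s i) with ha
  set w : ι → E := fun i => s i - a i • v with hw
  have hsw : ∀ i, s i = a i • v + w i := fun i => by simp [hw]
  have hvw : ∀ i, inner ℝ v (w i) = 0 := fun i => by
    simp [hw, inner_sub_right, inner_smul_right, hJ.norm_v, ha]
  have hvH : ∀ i, inner ℝ v (H (w i) - c i • w i) = 0 := fun i => by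
    rw [inner_sub_right, ← hJ.H_symm, hJ.H_v, inner_smul_left, inner_smul_right, hvw]; simp
  have hσ : Tendsto (fun i => ‖s i‖) l (𝓝 0) := by simpa using hN.tendsto_s.norm
  have hs : s =O[l] fun i => ‖s i‖ := (isBigO_refl _ _).norm_right
  -- the non-linear part of the difference equation
  set Y : ι → E := fun i => e i • v - (2 : ℝ) • (H (s i) - c i • s i) with hY
  have hY3 : Y =O[l] fun i => ‖s i‖ ^ 3 := by
    have hB : (fun i => B (s i) (m i)) =O[l] fun i => ‖s i‖ ^ 3 :=
      (clm_apply_isBigO (const_clm_apply_isBigO B hs) hm2).congr_right fun i => by ring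
    have hC : (fun i => C (s i) (s i) (s i)) =O[l] fun i => ‖s i‖ ^ 3 :=
      (clm_apply_isBigO (clm_apply_isBigO (const_clm_apply_isBigO C hs) hs)
        hs).congr_right fun i => by ring
    refine ((h2.isBigO.add (hB.const_smul_left (2 : ℝ))).add
      (hC.const_smul_left (1 / 3 : ℝ))).congr_left fun i => ?_
    simp only [Pi.smul_apply, hY]
    module
  have hYw : ∀ i, (2 : ℝ) • (H (w i) - c i • w i) = inner ℝ v (Y i) • v - Y i := fun i => by
    have e1 : Y i = (e i - 2 * (a i * (c₀ - c i))) • v - (2 : ℝ) • (H (w i) - c i • w i) := by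
      simp only [hY]
      rw [hsw i, map_add, map_smul, hJ.H_v]
      module
    have e2 : inner ℝ v (Y i) = e i - 2 * (a i * (c₀ - c i)) := by
      rw [e1, inner_sub_right, inner_smul_right, inner_smul_right, hvH, hvv]; ring
    rw [e2]
    nth_rw 1 [e1]
    module
  have hinner : ∀ {Z : ι → E} {α : ι → ℝ}, Z =O[l] α → (fun i => inner ℝ v (Z i)) =O[l] α :=
    fun hZ => const_clm_apply_isBigO (innerSL ℝ v) hZ
  have hinner' : ∀ {Z : ι → E} {α : ι → ℝ}, Z =o[l] α → (fun i => inner ℝ v (Z i)) =o[l] α :=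
    fun hZ => const_clm_apply_isLittleO (innerSL ℝ v) hZ
  have hwσ : w =O[l] fun i => ‖s i‖ ^ 3 := by
    refine (isBigO_transverse hJ hN.tendsto_c hvw).trans ?_
    have := ((smul_const_isBigO v (hinner hY3)).sub hY3).const_smul_left (1 / 2 : ℝ)
    refine this.congr_left fun i => ?_
    simp only [Pi.smul_apply]
    rw [← hYw]
    module
  have hsa : s =O[l] a := by
    obtain ⟨K, hK0, hK⟩ := hwσ.exists_pos
    refine isBigO_of_norm_le_add_mul (K := 1) (β := fun i => K * ‖s i‖ ^ 2) ?_ ?_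
    · simpa using (hσ.pow 2).const_mul K
    · filter_upwards [hK.bound] with i hi
      have := norm_add_le (a i • v) (w i)
      rw [← hsw, norm_smul, hJ.norm_v] at this
      simp only [norm_pow, norm_norm] at hi
      linarith
  have ha0 : Tendsto a l (𝓝 0) := by
    simpa using (tendsto_const_nhds (x := v)).inner hN.tendsto_s (𝕜 := ℝ)
  have hpow : ∀ n : ℕ, (fun i => ‖s i‖ ^ n) =O[l] fun i => a i ^ n := fun n => hsa.norm_left.pow n
  have hwa := hwσ.trans (hpow 3)
  have hma := hm2.trans (hpow 2)
  have hav : (fun i => a i • v) =O[l] a := smul_const_isBigO v (isBigO_refl _ _)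
  have hmp : (fun i => m i + (a i ^ 2 / 2) • p) =O[l] fun i => a i ^ 3 := by
    obtain ⟨k, hk, hkH⟩ := hJ.bounded_below
    have h34 : (fun i => a i ^ 4) =O[l] fun i => a i ^ 3 := pow_isBigO_pow ha0 (by norm_num)
    have hBw : (fun i => B (s i) (w i) + B (w i) (a i • v)) =O[l] fun i => a i ^ 3 :=
      (((clm_apply_isBigO (const_clm_apply_isBigO B hsa) hwa).congr_right
        (g₂ := fun i => a i ^ 4) fun i => by ring).add
        ((clm_apply_isBigO (const_clm_apply_isBigO B hwa) hav).congr_right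
        (g₂ := fun i => a i ^ 4) fun i => by ring)).trans h34
    have hH : (fun i => H (m i + (a i ^ 2 / 2) • p)) =O[l] fun i => a i ^ 3 := by
      refine (((h1.trans (hpow 3)).sub hBw).const_smul_left (1 / 2 : ℝ)).congr_left fun i => ?_
      simp only [Pi.smul_apply]
      rw [H.map_add, H.map_smul, hJ.H_p]
      have : B (s i) (s i) = B (s i) (w i) + B (w i) (a i • v) + (a i ^ 2) • B v v := by
        nth_rw 2 [hsw i]
        rw [map_add]
        nth_rw 1 [hsw i]
        simp only [map_add, map_smul, add_apply, smul_apply]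
        module
      rw [this]
      module
    exact (IsBigO.of_bound k (.of_forall fun i => hkH _)).trans hH
  refine ⟨hsa, hwa, hmp, ?_⟩
  have hB : (fun i => B (s i) (m i) + (a i ^ 3 / 2) • B v p) =o[l] fun i => a i ^ 3 := by
    have := ((clm_apply_isBigO (const_clm_apply_isBigO B hwa) hma).congr_right
        (g₂ := fun i => a i ^ 5) fun i => by ring).trans_isLittleO
          (pow_isLittleO_pow ha0 (by norm_num : 3 < 5))
    have h' := ((clm_apply_isBigO (const_clm_apply_isBigO B hav) hmp).congr_right
        (g₂ := fun i => a i ^ 4) fun i => by ring).trans_isLittleO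
          (pow_isLittleO_pow ha0 (by norm_num : 3 < 4))
    refine (this.add h').congr_left fun i => ?_
    have : B (s i) (m i) = B (a i • v) (m i) + B (w i) (m i) := by
      rw [← add_apply, ← map_add, ← hsw]
    rw [this]
    simp only [map_add, map_smul, smul_apply]
    module
  have hC : (fun i => C (s i) (s i) (s i) - (a i ^ 3) • C v v v) =o[l] fun i => a i ^ 3 := by
    have k1 := clm_apply_isBigO (clm_apply_isBigO (const_clm_apply_isBigO C hwa) hsa) hsa
    have k2 := clm_apply_isBigO (clm_apply_isBigO (const_clm_apply_isBigO C hav) hwa) hsa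
    have k3 := clm_apply_isBigO (clm_apply_isBigO (const_clm_apply_isBigO C hav) hav) hwa
    have := (((k1.congr_right (g₂ := fun i => a i ^ 5) fun i => by ring).add
      (k2.congr_right (g₂ := fun i => a i ^ 5) fun i => by ring)).add
      (k3.congr_right (g₂ := fun i => a i ^ 5) fun i => by ring)).trans_isLittleO
          (pow_isLittleO_pow ha0 (by norm_num : 3 < 5))
    refine this.congr_left fun i => ?_
    have : C (s i) (s i) (s i) = C (w i) (s i) (s i) + C (a i • v) (w i) (s i)
        + C (a i • v) (a i • v) (w i) + C (a i • v) (a i • v) (a i • v) := by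
      simp only [hw, map_sub, sub_apply]
      abel
    rw [this]
    simp only [map_smul, smul_apply]
    module
  have key := hinner' (((h2.trans_isBigO (hpow 3)).add (hB.const_smul_left (2 : ℝ))).add
    (hC.const_smul_left (1 / 3 : ℝ)))
  refine key.congr_left fun i => ?_
  have e1 : inner ℝ v (H (s i) - c i • s i) = a i * (c₀ - c i) := by
    rw [inner_sub_right, ← hJ.H_symm, hJ.H_v, inner_smul_left, inner_smul_right]
    simp [ha]
    ring
  simp only [Pi.smul_apply, inner_add_right, inner_sub_right, inner_smul_right, hvv, e1,
    flipCoeff]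
  rw [inner_sub_right, inner_smul_right] at e1
  ring_nf
  ring_nf at e1
  linarith

end IsNearCycle

end FlipJet

/-! ### Linearised stability in an adapted norm -/

section AdaptedNorm

variable {E : Type*} [NormedAddCommGroup E] [NormedSpace ℝ E]

/-- `J` is a strict contraction for some function `N` which is subadditive and comparable to the
norm; homogeneity of `N` plays no role. -/
def HasAdaptedContraction (J : E →L[ℝ] E) : Prop :=
  ∃ (N : E → ℝ) (k K θ : ℝ), 0 < k ∧ 0 < K ∧ 0 ≤ θ ∧ θ < 1 ∧ (∀ x y, N (x + y) ≤ N x + N y) ∧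
    (∀ x, k * ‖x‖ ≤ N x) ∧ (∀ x, N x ≤ K * ‖x‖) ∧ ∀ x, N (J x) ≤ θ * N x

/-- Iterates starting near a fixed point with contracting derivative converge geometrically. -/
lemma HasAdaptedContraction.exists_geometric_bound {J : E →L[ℝ] E} (hJ : HasAdaptedContraction J)
    {f : E → E} {p : E} (hfix : f p = p) (hf : HasFDerivAt f J p) :
    ∃ r > 0, ∃ M θ : ℝ, 0 < M ∧ 0 ≤ θ ∧ θ < 1 ∧
      ∀ x, ‖x - p‖ < r → ∀ n : ℕ, ‖f^[n] x - p‖ ≤ M * θ ^ n * ‖x - p‖ := by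
  obtain ⟨N, k, K, θ, hk, hK, hθ0, hθ1, hadd, hlow, hup, hcon⟩ := hJ
  have hε : 0 < k * (1 - θ) / (2 * K) := by have := sub_pos.2 hθ1; positivity
  obtain ⟨r, hr, hball⟩ := Metric.eventually_nhds_iff.1 ((hasFDerivAt_iff_isLittleO.1 hf).def hε)
  have hstep : ∀ y, N (y - p) < k * r → N (f y - p) ≤ (1 + θ) / 2 * N (y - p) := fun y hy => by
    have hyr : ‖y - p‖ < r := lt_of_mul_lt_mul_left ((hlow _).trans_lt hy) hk.le
    have h1 := hball (y := y) (by rwa [dist_eq_norm])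
    rw [hfix] at h1
    have h2 := hadd (J (y - p)) (f y - p - J (y - p))
    rw [add_sub_cancel] at h2
    have h3 : N (f y - p - J (y - p)) ≤ (1 - θ) / 2 * N (y - p) :=
      calc _ ≤ K * ‖f y - p - J (y - p)‖ := hup _
        _ ≤ K * (k * (1 - θ) / (2 * K) * ‖y - p‖) := by gcongr
        _ = (1 - θ) / 2 * (k * ‖y - p‖) := by field_simp
        _ ≤ _ := by gcongr; exact hlow _
    linarith [hcon (y - p)]
  have hiter : ∀ x, N (x - p) < k * r → ∀ n : ℕ,
      N (f^[n] x - p) ≤ ((1 + θ) / 2) ^ n * N (x - p) := fun x hx n => by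
    have hN0 : 0 ≤ N (x - p) := (by positivity : 0 ≤ k * ‖x - p‖).trans (hlow _)
    induction n with
    | zero => simp
    | succ n ih =>
      rw [Function.iterate_succ_apply', pow_succ']
      have hle : ((1 + θ) / 2) ^ n * N (x - p) ≤ N (x - p) :=
        mul_le_of_le_one_left hN0 (pow_le_one₀ (by linarith) (by linarith))
      refine (hstep _ (ih.trans_lt (hle.trans_lt hx))).trans ?_
      rw [mul_assoc]
      gcongr
  refine ⟨k * r / K, by positivity, K / k, (1 + θ) / 2, by positivity, by linarith, by linarith,
    fun x hx n => ?_⟩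
  rw [lt_div_iff₀ hK, mul_comm] at hx
  have h1 := (hlow _).trans (hiter x ((hup _).trans_lt hx) n)
  have h2 : ((1 + θ) / 2) ^ n * N (x - p) ≤ ((1 + θ) / 2) ^ n * (K * ‖x - p‖) := by
    gcongr
    exact hup _
  rw [div_mul_eq_mul_div, div_mul_eq_mul_div, le_div_iff₀ hk]
  linarith

lemma HasAdaptedContraction.isAsymptoticallyStableFixedPt {d : ℕ} {J : RSpace d →L[ℝ] RSpace d}
    (hJ : HasAdaptedContraction J) {f : RSpace d → RSpace d} {p : RSpace d} (hfix : f p = p)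
    (hf : HasFDerivAt f J p) : IsAsymptoticallyStableFixedPt f p := by
  obtain ⟨r, hr, M, θ, hM, hθ0, hθ1, h⟩ := hJ.exists_geometric_bound hfix hf
  refine ⟨hfix, fun U hU => ?_, ?_⟩
  · obtain ⟨ε, hε, hεU⟩ := Metric.mem_nhds_iff.1 hU
    refine ⟨Metric.ball p (min r (ε / M)), Metric.ball_mem_nhds _ (by positivity),
      fun x hx n => hεU ?_⟩
    rw [Metric.mem_ball, dist_eq_norm, lt_min_iff, lt_div_iff₀ hM] at hx
    rw [Metric.mem_ball, dist_eq_norm]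
    refine (h x hx.1 n).trans_lt (lt_of_le_of_lt ?_ hx.2)
    rw [mul_right_comm, mul_comm M]
    exact mul_le_of_le_one_right (by positivity) (pow_le_one₀ hθ0 hθ1.le)
  · filter_upwards [Metric.ball_mem_nhds p hr] with x hx
    rw [Metric.mem_ball, dist_eq_norm] at hx
    rw [tendsto_iff_norm_sub_tendsto_zero]
    refine squeeze_zero (fun n => norm_nonneg _) (h x hx) ?_
    simpa using ((tendsto_pow_atTop_nhds_zero_of_lt_one hθ0 hθ1).const_mul M).mul_const ‖x - p‖

end AdaptedNorm

section WeightedNorm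

variable {E : Type*} [NormedAddCommGroup E] [InnerProductSpace ℝ E]

/-- A criterion for contraction in the weighted norm `|α| + τ ‖w‖` of `x = α u + w`, `w ⟂ v`.
The direction `u` is almost an eigenvector: `J u = (1 - δ) u + r` with `r` small compared to `δ`,
while `J` contracts the complement of `v` at a fixed rate `Q`. -/
lemma hasAdaptedContraction_of_splitting {J : E →L[ℝ] E} {v u : E} {δ R P Q τ : ℝ}
    (hβ : inner ℝ v u ≠ (0 : ℝ)) (hδ0 : 0 < δ) (hδ1 : δ ≤ 1) (hQ0 : 0 ≤ Q) (hQ1 : Q < 1)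
    (hτ : 0 < τ) (hu : inner ℝ v (J u) / inner ℝ v u = 1 - δ)
    (hr : ‖J u - (1 - δ) • u‖ ≤ R)
    (hP : ∀ w, inner ℝ v w = 0 → |inner ℝ v (J w) / inner ℝ v u| ≤ P * ‖w‖)
    (hQ : ∀ w, inner ℝ v w = 0 → ‖J w - (inner ℝ v (J w) / inner ℝ v u) • u‖ ≤ Q * ‖w‖)
    (hPτ : P ≤ τ * ((1 - Q) / 2)) (hRτ : τ * R ≤ δ / 2) : HasAdaptedContraction J := by
  set α : E → ℝ := fun x => inner ℝ v x / inner ℝ v u with hα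
  have hαadd : ∀ x y, α (x + y) = α x + α y := fun x y => by
    simp only [hα, inner_add_right, add_div]
  have hαsmul : ∀ (t : ℝ) x, α (t • x) = t * α x := fun t x => by
    simp only [hα, inner_smul_right, mul_div_assoc]
  set θ := max (1 - δ / 2) ((1 + Q) / 2) with hθ
  have hαle : ∀ x, |α x| ≤ ‖v‖ / |inner ℝ v u| * ‖x‖ := fun x => by
    simp only [hα]
    rw [abs_div, div_mul_eq_mul_div]
    gcongr
    exact abs_real_inner_le_norm v x
  refine ⟨fun x => |α x| + τ * ‖x - α x • u‖, (max ‖u‖ (1 / τ))⁻¹,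
    ‖v‖ / |inner ℝ v u| + τ * (1 + ‖v‖ / |inner ℝ v u| * ‖u‖), θ, ?_, ?_, ?_, ?_, ?_, ?_, ?_, ?_⟩
  · have : 0 < max ‖u‖ (1 / τ) := lt_max_of_lt_right (by positivity)
    positivity
  · positivity
  · exact le_max_of_le_right (by linarith)
  · exact max_lt (by linarith) (by linarith)
  · intro x y
    have h1 := abs_add_le (α x) (α y)
    have h2 := norm_add_le (x - α x • u) (y - α y • u)
    have h3 : x + y - α (x + y) • u = (x - α x • u) + (y - α y • u) := by rw [hαadd]; module
    simp only [h3]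
    rw [hαadd]
    nlinarith
  · intro x
    have hpos : 0 < max ‖u‖ (1 / τ) := lt_max_of_lt_right (by positivity)
    rw [inv_mul_le_iff₀ hpos]
    have h1 : ‖x‖ ≤ |α x| * ‖u‖ + ‖x - α x • u‖ := by
      have := norm_add_le (α x • u) (x - α x • u)
      rwa [add_sub_cancel, norm_smul, Real.norm_eq_abs] at this
    have h2 : |α x| * ‖u‖ ≤ max ‖u‖ (1 / τ) * |α x| := by
      rw [mul_comm]
      gcongr
      exact le_max_left _ _
    have h3 : ‖x - α x • u‖ ≤ max ‖u‖ (1 / τ) * (τ * ‖x - α x • u‖) := by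
      have : (1 / τ) * (τ * ‖x - α x • u‖) = ‖x - α x • u‖ := by field_simp
      calc _ = (1 / τ) * (τ * ‖x - α x • u‖) := this.symm
        _ ≤ _ := by gcongr; exact le_max_right _ _
    linarith
  · intro x
    have h1 := hαle x
    have h2 : ‖x - α x • u‖ ≤ ‖x‖ + ‖v‖ / |inner ℝ v u| * ‖x‖ * ‖u‖ := by
      refine (norm_sub_le _ _).trans ?_
      rw [norm_smul, Real.norm_eq_abs]
      gcongr
    have h3 := mul_le_mul_of_nonneg_left h2 hτ.le
    calc |α x| + τ * ‖x - α x • u‖ ≤ ‖v‖ / |inner ℝ v u| * ‖x‖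
          + τ * (‖x‖ + ‖v‖ / |inner ℝ v u| * ‖x‖ * ‖u‖) := add_le_add h1 h3
      _ = _ := by ring
  · intro x
    set w := x - α x • u with hw
    have hvw : inner ℝ v w = 0 := by
      simp only [hw, hα, inner_sub_right, inner_smul_right]
      field_simp
      ring
    have hx : J x = α x • J u + J w := by rw [hw, map_sub, map_smul]; abel
    have hαu : α (J u) = 1 - δ := hu
    have hαx : α (J x) = α x * (1 - δ) + α (J w) := by rw [hx, hαadd, hαsmul, hαu]
    have h1 : |α (J x)| ≤ |α x| * (1 - δ) + P * ‖w‖ := by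
      rw [hαx]
      refine (abs_add_le _ _).trans (add_le_add ?_ (hP w hvw))
      rw [abs_mul, abs_of_nonneg (by linarith : 0 ≤ 1 - δ)]
    have h2 : ‖J x - α (J x) • u‖ ≤ |α x| * R + Q * ‖w‖ := by
      have : J x - α (J x) • u = α x • (J u - (1 - δ) • u) + (J w - α (J w) • u) := by
        rw [hαx, hx]; module
      rw [this]
      refine (norm_add_le _ _).trans (add_le_add ?_ (hQ w hvw))
      rw [norm_smul, Real.norm_eq_abs]
      gcongr
    have h3 : |α (J x)| + τ * ‖J x - α (J x) • u‖
        ≤ (1 - δ / 2) * |α x| + ((1 + Q) / 2) * (τ * ‖w‖) := by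
      have e1 := mul_le_mul_of_nonneg_left h2 hτ.le
      have e2 := mul_le_mul_of_nonneg_right hPτ (norm_nonneg w)
      have e3 := mul_le_mul_of_nonneg_right hRτ (abs_nonneg (α x))
      linarith
    refine h3.trans ?_
    rw [mul_add]
    gcongr
    exacts [le_max_left _ _, le_max_right _ _]

end WeightedNorm

/-! ### Linear stability of the cycles -/

section CycleStability

open Asymptotics

variable {E : Type*} [NormedAddCommGroup E] [InnerProductSpace ℝ E]
  {ι : Type*} {l : Filter ι} {g : E → E} {c₀ : ℝ} {v p : E} {H : E →L[ℝ] E}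
  {B : E →L[ℝ] E →L[ℝ] E} {C : E →L[ℝ] E →L[ℝ] E →L[ℝ] E} {m s : ι → E} {c e : ι → ℝ}

/-- Second-order expansion of the composition of two operators along almost-exchanged vectors. -/
lemma comp_expansion {A₁ A₂ : ι → E →L[ℝ] E} {A₀ : E →L[ℝ] E} {a : ι → ℝ} {u₁ u₂ : ι → E} {y : E}
    (ha : Tendsto a l (𝓝 0)) (d₁ : (fun i => A₁ i - A₀) =O[l] a)
    (d₂ : (fun i => A₂ i - A₀) =O[l] a)
    (t₁ : (fun i => A₁ i (u₁ i) + u₂ i + a i ^ 2 • y) =o[l] fun i => a i ^ 2)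
    (t₂ : (fun i => A₂ i (u₂ i) + u₁ i + a i ^ 2 • y) =o[l] fun i => a i ^ 2) :
    ((fun i => (A₂ i ∘L A₁ i) (u₁ i) - u₁ i - a i ^ 2 • (y - A₀ y)) =o[l] fun i => a i ^ 2) ∧
    (fun i => A₂ i ∘L A₁ i - A₀ ∘L A₀) =O[l] a := by
  have a1 : a =o[l] fun _ => (1 : ℝ) := (isLittleO_one_iff ℝ).2 ha
  have hA₂O : A₂ =O[l] fun _ => (1 : ℝ) := by
    refine ((d₂.trans a1.isBigO).add (isBigO_const_one ℝ A₀ l)).congr_left fun i => ?_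
    abel
  have hA₁O : A₁ =O[l] fun _ => (1 : ℝ) := by
    refine ((d₁.trans a1.isBigO).add (isBigO_const_one ℝ A₀ l)).congr_left fun i => ?_
    abel
  constructor
  · have k1 : (fun i => A₂ i (A₁ i (u₁ i) + u₂ i + a i ^ 2 • y)) =o[l] fun i => a i ^ 2 := by
      refine (IsBigO.trans_isLittleO (IsBigO.of_norm_le fun i => ?_)
        (hA₂O.norm_left.mul_isLittleO t₁.norm_left)).congr_right fun i => one_mul _
      exact (A₂ i).le_opNorm _
    have k3 : (fun i => (A₂ i - A₀) (a i ^ 2 • y)) =o[l] fun i => a i ^ 2 :=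
      (clm_apply_isLittleO (d₂.trans_isLittleO a1)
        (smul_const_isBigO y (isBigO_refl _ _))).congr_right fun i => one_mul _
    refine ((k1.sub t₂).sub k3).congr_left fun i => ?_
    simp only [ContinuousLinearMap.comp_apply, map_add, sub_apply, map_smul]
    module
  · have k1 : (fun i => (A₂ i - A₀) ∘L A₁ i) =O[l] a :=
      ((IsBigO.of_norm_le fun i => by simpa only [norm_mul, norm_norm] using
        ContinuousLinearMap.opNorm_comp_le (A₂ i - A₀) (A₁ i)).trans
        (d₂.norm_left.mul hA₁O.norm_left)).congr_right fun i => mul_one _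
    have k2 : (fun i => A₀ ∘L (A₁ i - A₀)) =O[l] a :=
      (IsBigO.of_norm_le fun i => by simpa only [norm_mul, norm_norm] using
        ContinuousLinearMap.opNorm_comp_le A₀ (A₁ i - A₀)).trans
        (d₁.norm_left.const_mul_left ‖A₀‖)
    refine (k1.add k2).congr_left fun i => ?_
    rw [ContinuousLinearMap.sub_comp, ContinuousLinearMap.comp_sub]
    abel

/-- Contraction of an operator `J` close to `A₀ ∘ A₀`, where `A₀` reflects `v` and contracts its
complement: a drift `-μ a²` along the almost fixed vector `u` beats the off-diagonal terms of
order `a`, since the residual of `u` is of order `a²`. The weight of the complement is taken of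
order `a`. -/
lemma hasAdaptedContraction_of_drift {J A₀ : E →L[ℝ] E} {v u y : E} {a ρ K μ : ℝ}
    (hv : ‖v‖ = 1) (hρ0 : 0 ≤ ρ) (hρ1 : ρ < 1) (hK : 0 < K) (hμ : 0 < μ)
    (hA₀v : ∀ x, inner ℝ v (A₀ x) = -inner ℝ v x)
    (hA₀w : ∀ w, inner ℝ v w = 0 → ‖A₀ w‖ ≤ ρ * ‖w‖) (hy : inner ℝ v y = -μ) (ha : a ≠ 0)
    (hD : ‖J - A₀ ∘L A₀‖ ≤ K * |a|) (hu : ‖u - v‖ < 1 / 2)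
    (hJu : ‖J u - u - a ^ 2 • y‖ ≤ μ / 2 * a ^ 2)
    (s₁ : 4 * μ * a ^ 2 < 1) (s₂ : 5 * K * |a| < (1 - ρ) / 2)
    (s₃ : 4 * K / (1 - (1 + ρ) / 2) * (5 * (‖y‖ + μ)) * |a| < μ / 8) :
    HasAdaptedContraction J := by
  have hvle : ∀ x, |inner ℝ v x| ≤ ‖x‖ := fun x => by
    simpa [hv] using abs_real_inner_le_norm v x
  have hapos : 0 < |a| := abs_pos.2 ha
  have ha2 : 0 < a ^ 2 := by positivity
  have hQ1 : 0 < 1 - (1 + ρ) / 2 := by linarith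
  have hun : ‖u‖ ≤ 2 := by
    have := norm_add_le v (u - v)
    rw [add_sub_cancel, hv] at this
    linarith
  obtain ⟨β, hβ⟩ : ∃ β : ℝ, inner ℝ v u = β := ⟨_, rfl⟩
  have hβ' : |β - 1| < 1 / 2 := by
    have : β - 1 = inner ℝ v (u - v) := by
      rw [inner_sub_right, real_inner_self_eq_norm_sq, hv, hβ, one_pow]
    rw [this]
    exact (hvle _).trans_lt hu
  obtain ⟨hβ1, hβ2⟩ := abs_lt.1 hβ'
  have hβpos : 0 < β := by linarith
  -- the residual `r = J u - u` has size `O(a²)`, and its component along `v` is negative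
  obtain ⟨r, hr⟩ : ∃ r, r = J u - u := ⟨_, rfl⟩
  rw [← hr] at hJu
  have hvr : |inner ℝ v r + μ * a ^ 2| ≤ μ / 2 * a ^ 2 := by
    have : inner ℝ v r + μ * a ^ 2 = inner ℝ v (r - a ^ 2 • y) := by
      rw [inner_sub_right, inner_smul_right, hy]; ring
    rw [this]
    exact (hvle _).trans hJu
  have hrn : ‖r‖ ≤ (‖y‖ + μ) * a ^ 2 := by
    have h1 := norm_add_le (r - a ^ 2 • y) (a ^ 2 • y)
    rw [sub_add_cancel, norm_smul, Real.norm_of_nonneg (sq_nonneg _)] at h1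
    nlinarith [mul_pos hμ ha2]
  obtain ⟨γ, hγ⟩ : ∃ γ : ℝ, inner ℝ v r = γ := ⟨_, rfl⟩
  rw [hγ] at hvr
  obtain ⟨hvr1, hvr2⟩ := abs_le.1 hvr
  have hμa : 0 < μ * a ^ 2 := mul_pos hμ ha2
  have hδlow : μ / 4 * a ^ 2 ≤ -(γ / β) := by
    rw [← neg_div, le_div_iff₀ hβpos]
    nlinarith
  have hδ1 : -(γ / β) ≤ 1 := by
    rw [← neg_div, div_le_one hβpos]
    nlinarith
  have hJu' : J u = u + r := by rw [hr]; abel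
  have hdiv : ∀ x : E, |inner ℝ v x / β| ≤ 2 * ‖x‖ := fun x => by
    rw [abs_div, abs_of_pos hβpos, div_le_iff₀ hβpos]
    nlinarith [norm_nonneg x, hvle x]
  have hproj : ∀ x : E, ‖x - (inner ℝ v x / β) • u‖ ≤ 5 * ‖x‖ := fun x => by
    refine (norm_sub_le _ _).trans ?_
    rw [norm_smul, Real.norm_eq_abs]
    have := mul_le_mul (hdiv x) hun (norm_nonneg u) (by positivity)
    linarith
  obtain ⟨D, hDdef⟩ : ∃ D, D = J - A₀ ∘L A₀ := ⟨_, rfl⟩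
  rw [← hDdef] at hD
  have hJD : ∀ w, J w = A₀ (A₀ w) + D w := fun w => by simp [hDdef]
  have hDn : ∀ w, ‖D w‖ ≤ K * |a| * ‖w‖ := fun w => (D.le_opNorm w).trans (by gcongr)
  have hvJ : ∀ w, inner ℝ v w = 0 → inner ℝ v (J w) = inner ℝ v (D w) :=
    fun w hw => by rw [hJD w, inner_add_right, hA₀v, hA₀v, hw]; simp
  refine hasAdaptedContraction_of_splitting (v := v) (u := u) (δ := -(γ / β))
    (R := 5 * (‖y‖ + μ) * a ^ 2) (P := 2 * (K * |a|)) (Q := (1 + ρ) / 2)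
    (τ := 4 * K / (1 - (1 + ρ) / 2) * |a|) (by rw [hβ]; exact hβpos.ne')
    (lt_of_lt_of_le (by positivity) hδlow) hδ1 (by positivity) (by linarith) (by positivity)
    ?_ ?_ ?_ ?_ ?_ ?_
  · rw [hJu', inner_add_right, hβ, hγ, add_div, div_self hβpos.ne']
    ring
  · have : J u - (1 - -(γ / β)) • u = r - (inner ℝ v r / β) • u := by rw [hJu', hγ]; module
    rw [this]
    refine (hproj r).trans ?_
    rw [mul_assoc]
    gcongr
  · intro w hw
    rw [hvJ w hw, hβ]
    refine (hdiv _).trans ?_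
    rw [mul_assoc]
    gcongr
    exact hDn w
  · intro w hw
    have e1 : J w - (inner ℝ v (J w) / β) • u = A₀ (A₀ w) + (D w - (inner ℝ v (D w) / β) • u) := by
      rw [hvJ w hw, hJD w]
      abel
    have e2 : ‖A₀ (A₀ w)‖ ≤ ρ * ‖w‖ := by
      refine (hA₀w _ (by rw [hA₀v, hw, neg_zero])).trans ?_
      gcongr
      exact (hA₀w w hw).trans (mul_le_of_le_one_left (norm_nonneg _) hρ1.le)
    rw [hβ, e1]
    refine (norm_add_le _ _).trans ?_
    have e3 := hproj (D w)
    have e4 := hDn w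
    have e5 : 5 * K * |a| * ‖w‖ ≤ (1 - ρ) / 2 * ‖w‖ := by gcongr
    linarith
  · have : 4 * K / (1 - (1 + ρ) / 2) * |a| * ((1 - (1 + ρ) / 2) / 2) = 2 * (K * |a|) := by
      generalize 1 - (1 + ρ) / 2 = q at hQ1 ⊢
      field_simp
      ring
    exact this.ge
  · calc 4 * K / (1 - (1 + ρ) / 2) * |a| * (5 * (‖y‖ + μ) * a ^ 2)
        = (4 * K / (1 - (1 + ρ) / 2) * (5 * (‖y‖ + μ)) * |a|) * a ^ 2 := by ring
      _ ≤ μ / 8 * a ^ 2 := by gcongr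
      _ ≤ -(γ / β) / 2 := by linarith

namespace IsNearCycle

/-- Exchanging the two points of a cycle. -/
lemma neg (hN : IsNearCycle l g c₀ v m s c e) : IsNearCycle l g c₀ v m (-s) c (-e) where
  tendsto_m := hN.tendsto_m
  tendsto_s := by
    have := hN.tendsto_s.neg
    rw [neg_zero] at this
    exact this
  tendsto_c := hN.tendsto_c
  sum_eq := by
    filter_upwards [hN.sum_eq] with i hi
    rw [Pi.neg_apply, ← sub_eq_add_neg, sub_neg_eq_add, add_comm, hi]
  diff_eq := by
    filter_upwards [hN.diff_eq] with i hi
    rw [Pi.neg_apply, Pi.neg_apply, ← sub_eq_add_neg, sub_neg_eq_add, neg_smul, ← hi]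
    module

lemma tendsto_inner (hN : IsNearCycle l g c₀ v m s c e) :
    Tendsto (fun i => (inner ℝ v (s i) : ℝ)) l (𝓝 0) := by
  simpa using (tendsto_const_nhds (x := v)).inner hN.tendsto_s (𝕜 := ℝ)

/-- On genuine cycles the bifurcation equation determines the parameter. -/
lemma parameter_expansion (hJ : IsFlipJet g c₀ v p H B C) (hN : IsNearCycle l g c₀ v m s c 0)
    (hs : ∀ᶠ i in l, s i ≠ 0) :
    (∀ᶠ i in l, (inner ℝ v (s i) : ℝ) ≠ 0) ∧
    (fun i => c₀ - c i - flipCoeff v p B C * inner ℝ v (s i) ^ 2) =o[l]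
      (fun i => (inner ℝ v (s i) : ℝ) ^ 2) := by
  obtain ⟨h1, -, -, h4⟩ := hN.reduction hJ
  have ha : ∀ᶠ i in l, (inner ℝ v (s i) : ℝ) ≠ 0 := by
    obtain ⟨K, hK⟩ := h1.bound
    filter_upwards [hK, hs] with i hi hsi h0
    rw [h0, norm_zero, mul_zero] at hi
    exact hsi (norm_le_zero_iff.1 hi)
  refine ⟨ha, ?_⟩
  have h5 := (isBigO_refl (fun i => (inner ℝ v (s i) : ℝ)⁻¹) l).mul_isLittleO
    (h4.const_mul_left (-1 / 2))
  refine h5.congr' ?_ ?_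
  · filter_upwards [ha] with i hi
    simp only [Pi.zero_apply]
    field_simp
    ring
  · filter_upwards [ha] with i hi
    field_simp

/-- The derivative of `g` at a point of a near-cycle, to second order. -/
lemma fderiv_expansion (hJ : IsFlipJet g c₀ v p H B C) (hN : IsNearCycle l g c₀ v m s c e) :
    (fun i => fderiv ℝ g (m i + s i) - (H + inner ℝ v (s i) • B v
      + (inner ℝ v (s i) ^ 2 / 2) • (C v v - B p))) =o[l]
      (fun i => (inner ℝ v (s i) : ℝ) ^ 2) := by
  obtain ⟨h1, h2, h3, -⟩ := hN.reduction hJ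
  have ha0 := hN.tendsto_inner
  set a : ι → ℝ := fun i => inner ℝ v (s i) with ha
  have h23 : (fun i => a i ^ 3) =o[l] fun i => a i ^ 2 := pow_isLittleO_pow ha0 (by norm_num)
  have ha2 : (fun i => a i ^ 2) =O[l] a := by
    simpa using pow_isBigO_pow ha0 one_le_two
  have hx : Tendsto (fun i => m i + s i) l (𝓝 0) := by simpa using hN.tendsto_m.add hN.tendsto_s
  have hav : (fun i => a i • v) =O[l] a := smul_const_isBigO v (isBigO_refl _ _)
  have hm : m =O[l] fun i => a i ^ 2 := (hN.isBigO_midpoint hJ).trans (h1.norm_left.pow 2)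
  have hxa : (fun i => m i + s i) =O[l] a := (hm.trans ha2).add h1
  have hxv : (fun i => (m i + s i) - a i • v) =O[l] fun i => a i ^ 2 :=
    (hm.add (h2.trans h23.isBigO)).congr_left fun i => by module
  have hxv' : (fun i => (m i + s i) - (a i • v - (a i ^ 2 / 2) • p)) =o[l] fun i => a i ^ 2 :=
    ((h3.add h2).trans_isLittleO h23).congr_left fun i => by module
  have hT := (hJ.taylor_fderiv.comp_tendsto hx).trans_isBigO (hxa.norm_left.pow 2)
  have hB := const_clm_apply_isLittleO B hxv'
  have hC : (fun i => C (m i + s i) (m i + s i) - (a i ^ 2) • C v v) =o[l] fun i => a i ^ 2 := by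
    have k1 := (clm_apply_isBigO (const_clm_apply_isBigO C hxv) hxa).congr_right
      (g₂ := fun i => a i ^ 3) fun i => by ring
    have k2 := (clm_apply_isBigO (const_clm_apply_isBigO C hav) hxv).congr_right
      (g₂ := fun i => a i ^ 3) fun i => by ring
    refine ((k1.add k2).trans_isLittleO h23).congr_left fun i => ?_
    generalize m i + s i = x
    simp only [map_sub, map_smul, sub_apply, smul_apply]
    module
  refine ((hT.add hB).add (hC.const_smul_left (1 / 2 : ℝ))).congr_left fun i => ?_
  simp only [Function.comp_apply, Pi.smul_apply]
  generalize m i + s i = x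
  simp only [map_sub, map_smul]
  module

/-- One step of the linearised map at a point of a cycle, applied to the tangent vector `v - a p`
of the branch of cycles: it is sent to minus the tangent vector at the other point, up to an
explicit second-order term. -/
lemma step_tangent (hJ : IsFlipJet g c₀ v p H B C) (hN : IsNearCycle l g c₀ v m s c 0)
    (hs : ∀ᶠ i in l, s i ≠ 0) :
    (fun i => (v - inner ℝ v (s i) • p) - (2 / c i) • fderiv ℝ g (m i + s i)
        (v - inner ℝ v (s i) • p) + (v + inner ℝ v (s i) • p)
        + (2 / c₀ * inner ℝ v (s i) ^ 2) • (flipCoeff v p B C • v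
          + ((1 / 2 : ℝ) • C v v v - (3 / 2 : ℝ) • B v p))) =o[l]
      (fun i => (inner ℝ v (s i) : ℝ) ^ 2) := by
  have hF := hN.fderiv_expansion hJ
  have hpar := (hN.parameter_expansion hJ hs).2
  have ha0 := hN.tendsto_inner
  set κ := flipCoeff v p B C
  set a : ι → ℝ := fun i => inner ℝ v (s i) with ha
  set z : E := (1 / 2 : ℝ) • C v v v - (3 / 2 : ℝ) • B v p with hz
  have hcc : Tendsto (fun i => 2 / c i) l (𝓝 (2 / c₀)) :=
    tendsto_const_nhds.div hN.tendsto_c hJ.pos.ne'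
  have hcO : (fun i => 2 / c i) =O[l] fun _ => (1 : ℝ) := hcc.isBigO_one ℝ
  have hc0 : ∀ᶠ i in l, 0 < c i := hN.tendsto_c.eventually (lt_mem_nhds hJ.pos)
  have h23 : (fun i => a i ^ 3) =o[l] fun i => a i ^ 2 := pow_isLittleO_pow ha0 (by norm_num)
  have hu : (fun i => v - a i • p) =O[l] fun _ => (1 : ℝ) :=
    ((tendsto_const_nhds (x := v)).sub (ha0.smul_const p)).isBigO_one ℝ
  -- the image of the tangent vector under the derivative of `g`
  have hFu : (fun i => fderiv ℝ g (m i + s i) (v - a i • p) - (c₀ • v + a i ^ 2 • z))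
      =o[l] fun i => a i ^ 2 := by
    have k1 := (clm_apply_isLittleO hF hu).congr_right (g₂ := fun i => a i ^ 2) fun i => by ring
    have k2 : (fun i => a i ^ 3 • ((1 / 2 : ℝ) • B p p - (1 / 2 : ℝ) • C v v p))
        =o[l] fun i => a i ^ 2 := smul_const_isLittleO _ h23
    refine (k1.add k2).congr_left fun i => ?_
    simp only [sub_apply, add_apply, smul_apply, map_sub, map_smul, hJ.H_v, hJ.H_p,
      hJ.B_comm p v, hz]
    module
  have k1 : (fun i => (2 / c i) • (fderiv ℝ g (m i + s i) (v - a i • p)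
      - (c₀ • v + a i ^ 2 • z))) =o[l] fun i => a i ^ 2 :=
    (hcO.smul_isLittleO hFu).congr_right fun i => by simp
  have k2 : (fun i => (2 / c i * (c₀ - c i - κ * a i ^ 2)) • v) =o[l] fun i => a i ^ 2 :=
    smul_const_isLittleO v ((hcO.mul_isLittleO hpar).congr_right fun i => by simp [ha])
  have k3 : (fun i => ((2 / c₀ - 2 / c i) * a i ^ 2) • (κ • v + z)) =o[l] fun i => a i ^ 2 := by
    refine smul_const_isLittleO _ ?_
    have : (fun i => 2 / c₀ - 2 / c i) =o[l] fun _ => (1 : ℝ) := by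
      rw [isLittleO_one_iff]
      simpa using hcc.const_sub (2 / c₀)
    exact (this.mul_isBigO (isBigO_refl (fun i => a i ^ 2) l)).congr_right fun i => by simp
  refine ((k3.sub k1).sub k2).congr' ?_ .rfl
  filter_upwards [hc0] with i hi
  have e1 : 2 / c i * (c₀ - c i - κ * a i ^ 2) = 2 / c i * c₀ - 2 - 2 / c i * (κ * a i ^ 2) := by
    field_simp
  rw [e1]
  module

/-- One step of the linearised map along a cycle differs from that at the equilibrium by `O(a)`. -/
lemma step_sub_isBigO (hJ : IsFlipJet g c₀ v p H B C) (hN : IsNearCycle l g c₀ v m s c 0)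
    (hs : ∀ᶠ i in l, s i ≠ 0) :
    (fun i => (ContinuousLinearMap.id ℝ E - (2 / c i) • fderiv ℝ g (m i + s i))
      - (ContinuousLinearMap.id ℝ E - (2 / c₀) • H)) =O[l]
      (fun i => (inner ℝ v (s i) : ℝ)) := by
  have hF := hN.fderiv_expansion hJ
  have hpar := (hN.parameter_expansion hJ hs).2
  have ha0 := hN.tendsto_inner
  set κ := flipCoeff v p B C
  set a : ι → ℝ := fun i => inner ℝ v (s i) with ha
  have ha2 : (fun i => a i ^ 2) =O[l] a := by
    simpa using pow_isBigO_pow ha0 one_le_two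
  have hcO : (fun i => 2 / c i) =O[l] fun _ => (1 : ℝ) :=
    (tendsto_const_nhds.div hN.tendsto_c hJ.pos.ne').isBigO_one ℝ
  have hc0 : ∀ᶠ i in l, 0 < c i := hN.tendsto_c.eventually (lt_mem_nhds hJ.pos)
  have hFH : (fun i => fderiv ℝ g (m i + s i) - H) =O[l] a := by
    have k1 : (fun i => a i • B v) =O[l] a :=
      smul_const_isBigO (E := E →L[ℝ] E) (B v) (isBigO_refl a l)
    have k2 : (fun i => (a i ^ 2 / 2) • (C v v - B p)) =O[l] a :=
      smul_const_isBigO (E := E →L[ℝ] E) _ ((ha2.const_mul_left (1 / 2)).congr_left fun i => by ring)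
    refine (((hF.isBigO.trans ha2).add k1).add k2).congr_left fun i => ?_
    module
  have hcc : (fun i => c₀ - c i) =O[l] a := by
    refine ((hpar.isBigO.trans ha2).add (ha2.const_mul_left κ)).congr_left fun i => ?_
    ring
  have k1 : (fun i => (2 / c i) • (fderiv ℝ g (m i + s i) - H)) =O[l] a :=
    (hcO.smul hFH).congr_right fun i => by simp
  have k2 : (fun i => (2 / c i * (c₀ - c i) * (1 / c₀)) • H) =O[l] a :=
    smul_const_isBigO (E := E →L[ℝ] E) H
      (((hcO.mul hcc).mul (isBigO_const_one ℝ (1 / c₀) l)).congr_right fun i => by simp)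
  have hc00 := hJ.pos
  refine (k1.neg_left.sub k2).congr' ?_ .rfl
  filter_upwards [hc0] with i hi
  have : 2 / c i * (c₀ - c i) * (1 / c₀) = 2 / c i - 2 / c₀ := by
    field_simp
  rw [this]
  module

/-- Supercritical case: all cycles close to the equilibrium are linearly stable. On the tangent
vector `v - a p` of the branch of cycles, the linearised return map is the identity up to a term of
order `a²`, whose component along `v` is negative exactly when `flipCoeff` is positive. -/
lemma eventually_hasAdaptedContraction (hJ : IsFlipJet g c₀ v p H B C)
    (hN : IsNearCycle l g c₀ v m s c 0) (hs : ∀ᶠ i in l, s i ≠ 0)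
    (hκ : 0 < flipCoeff v p B C) :
    ∀ᶠ i in l, HasAdaptedContraction
      ((ContinuousLinearMap.id ℝ E - (2 / c i) • fderiv ℝ g (m i - s i)) ∘L
      (ContinuousLinearMap.id ℝ E - (2 / c i) • fderiv ℝ g (m i + s i))) := by
  have hs' : ∀ᶠ i in l, (-s) i ≠ 0 := hs.mono fun i hi => by simpa using hi
  have hN' : IsNearCycle l g c₀ v m (-s) c 0 := by simpa using hN.neg
  have t₁ := hN.step_tangent hJ hs
  have t₂ := hN'.step_tangent hJ hs'
  have d₁ := hN.step_sub_isBigO hJ hs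
  have d₂ := hN'.step_sub_isBigO hJ hs'
  have ha := (hN.parameter_expansion hJ hs).1
  have ha0 := hN.tendsto_inner
  have hvv : inner ℝ v v = (1 : ℝ) := by rw [real_inner_self_eq_norm_sq, hJ.norm_v, one_pow]
  have hc0 := hJ.pos
  simp only [Pi.neg_apply, inner_neg_right, neg_smul, sub_neg_eq_add, ← sub_eq_add_neg,
    neg_sq, isBigO_neg_right] at t₂ d₂
  obtain ⟨a, hadef⟩ : ∃ a : ι → ℝ, (fun i => inner ℝ v (s i)) = a := ⟨_, rfl⟩
  simp only [fun i => congrFun hadef i] at t₁ t₂ d₁ d₂ ha ha0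
  obtain ⟨A₀, hA₀⟩ : ∃ A₀, ContinuousLinearMap.id ℝ E - (2 / c₀) • H = A₀ := ⟨_, rfl⟩
  obtain ⟨y₀, hy₀⟩ : ∃ y₀, flipCoeff v p B C • v
    + ((1 / 2 : ℝ) • C v v v - (3 / 2 : ℝ) • B v p) = y₀ := ⟨_, rfl⟩
  rw [hA₀] at d₁ d₂
  rw [hy₀] at t₁ t₂
  have hA₀v : ∀ x, inner ℝ v (A₀ x) = -inner ℝ v x := fun x => by
    rw [← hA₀, sub_apply, smul_apply, inner_sub_right, inner_smul_right, ← hJ.H_symm,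
      hJ.H_v, inner_smul_left, ContinuousLinearMap.id_apply]
    simp only [conj_trivial]
    field_simp
    ring
  have hy₀v : inner ℝ v y₀ = -(2 * flipCoeff v p B C) := by
    rw [← hy₀, inner_add_right, inner_sub_right, inner_smul_right, inner_smul_right,
      inner_smul_right, hvv, flipCoeff]
    ring
  obtain ⟨hu, hD⟩ := comp_expansion (l := l) (y := (2 / c₀) • y₀) (u₁ := fun i => v - a i • p)
    (u₂ := fun i => v + a i • p) ha0 d₁ d₂
    (t₁.congr_left fun i => by simp only [sub_apply, smul_apply, ContinuousLinearMap.id_apply]; module)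
    (t₂.congr_left fun i => by simp only [sub_apply, smul_apply, ContinuousLinearMap.id_apply]; module)
  obtain ⟨y, hydef⟩ : ∃ y, (2 / c₀) • y₀ - A₀ ((2 / c₀) • y₀) = y := ⟨_, rfl⟩
  have hy : inner ℝ v y = -(8 * flipCoeff v p B C / c₀) := by
    rw [← hydef, inner_sub_right, hA₀v, inner_smul_right, hy₀v]
    ring
  rw [hydef] at hu
  obtain ⟨ρ, hρ0, hρ1, hρ⟩ := hJ.contract
  obtain ⟨K, hK0, hK⟩ := hD.exists_pos
  have hμ0 : 0 < 8 * flipCoeff v p B C / c₀ := by positivity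
  have sm : ∀ {t : ℝ} (q : ℝ), 0 < t → ∀ᶠ i in l, q * |a i| < t := fun q ht => by
    have : Tendsto (fun i => q * |a i|) l (𝓝 0) := by simpa using ha0.abs.const_mul q
    exact this.eventually (gt_mem_nhds ht)
  have hsq : Tendsto (fun i => 4 * (8 * flipCoeff v p B C / c₀) * a i ^ 2) l (𝓝 0) := by
    simpa using (ha0.pow 2).const_mul (4 * (8 * flipCoeff v p B C / c₀))
  filter_upwards [ha, hK.bound, hu.def (half_pos hμ0), sm ‖p‖ (by norm_num : (0 : ℝ) < 1 / 2),
    hsq.eventually (gt_mem_nhds one_pos), sm (5 * K) (by linarith : 0 < (1 - ρ) / 2),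
    sm _ (by positivity : 0 < 8 * flipCoeff v p B C / c₀ / 8)] with i hai hKi hui hp hμa hKa hMG
  refine hasAdaptedContraction_of_drift (u := v - a i • p) hJ.norm_v hρ0 hρ1 hK0 hμ0 hA₀v
    (fun w hw => ?_) hy hai (by simpa using hKi) ?_ (by simpa using hui) hμa hKa hMG
  · simpa [← hA₀] using hρ w hw
  · rw [sub_sub_cancel_left, norm_neg, norm_smul, Real.norm_eq_abs, mul_comm]
    exact hp

end IsNearCycle

end CycleStability

/-! ### Existence of two-cycles past the flip -/

section Existence

open Asymptotics

variable {E : Type*} [NormedAddCommGroup E] [InnerProductSpace ℝ E]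
  {g : E → E} {c₀ : ℝ} {v p : E} {H : E →L[ℝ] E}
  {B : E →L[ℝ] E →L[ℝ] E} {C : E →L[ℝ] E →L[ℝ] E →L[ℝ] E}

namespace IsFlipJet

lemma map_zero (hJ : IsFlipJet g c₀ v p H B C) : g 0 = 0 := by
  obtain ⟨K, hK⟩ := hJ.isBigO_sub_linear.bound
  simpa using hK.self_of_nhds

/-- Lyapunov–Schmidt reduction: by the implicit function theorem, the cycle equations up to a defect
along `v` can be solved for the midpoint and half-width `(m, s)` as functions of `a = ⟪v, s⟫` and
the parameter `c`. -/
lemma exists_branch [FiniteDimensional ℝ E] (hJ : IsFlipJet g c₀ v p H B C) :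
    ∃ φ : ℝ × ℝ → E × E, Tendsto φ (𝓝 (0, c₀)) (𝓝 0) ∧ (∀ᶠ x in 𝓝 (0, c₀), ContinuousAt φ x) ∧
      ∀ᶠ x in 𝓝 (0, c₀), inner ℝ v (φ x).2 = x.1 ∧
        g ((φ x).1 + (φ x).2) + g ((φ x).1 - (φ x).2) = 0 ∧
        g ((φ x).1 + (φ x).2) - g ((φ x).1 - (φ x).2) - (2 * x.2) • (φ x).2 =
          (inner ℝ v (g ((φ x).1 + (φ x).2) - g ((φ x).1 - (φ x).2) - (2 * x.2) • (φ x).2) : ℝ)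
            • v := by
  have : CompleteSpace E := FiniteDimensional.complete ℝ E
  have hvv : inner ℝ v v = (1 : ℝ) := by rw [real_inner_self_eq_norm_sq, hJ.norm_v, one_pow]
  let pm : (ℝ × ℝ) × (E × E) →L[ℝ] E := .fst ℝ E E ∘L .snd ℝ (ℝ × ℝ) (E × E)
  let ps : (ℝ × ℝ) × (E × E) →L[ℝ] E := .snd ℝ E E ∘L .snd ℝ (ℝ × ℝ) (E × E)
  let pa : (ℝ × ℝ) × (E × E) →L[ℝ] ℝ := .fst ℝ ℝ ℝ ∘L .fst ℝ (ℝ × ℝ) (E × E)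
  let pc : (ℝ × ℝ) × (E × E) →L[ℝ] ℝ := .snd ℝ ℝ ℝ ∘L .fst ℝ (ℝ × ℝ) (E × E)
  -- the orthogonal projection along `v`
  let P : E →L[ℝ] E := .id ℝ E - (innerSL ℝ v).smulRight v
  let T : (ℝ × ℝ) × (E × E) →L[ℝ] E := (innerSL ℝ v ∘L ps - pa).smulRight v
  let u : (ℝ × ℝ) × (E × E) := ((0, c₀), (0, 0))
  let F : (ℝ × ℝ) × (E × E) → E × E := fun x =>
    (g ((pm + ps) x) + g ((pm - ps) x),
      P (g ((pm + ps) x) - g ((pm - ps) x) - (2 * pc x) • ps x) + T x)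
  have hP : ∀ x, P x = x - (inner ℝ v x : ℝ) • v := fun x => rfl
  have hvP : ∀ x, inner ℝ v (P x) = (0 : ℝ) := fun x => by
    rw [hP, inner_sub_right, inner_smul_right, hvv, mul_one, sub_self]
  have h1 : HasStrictFDerivAt (fun x => g ((pm + ps) x)) (H ∘L (pm + ps)) u := by
    refine HasStrictFDerivAt.comp u ?_ (pm + ps).hasStrictFDerivAt
    simpa [u, pm, ps] using hJ.strict
  have h2 : HasStrictFDerivAt (fun x => g ((pm - ps) x)) (H ∘L (pm - ps)) u := by
    refine HasStrictFDerivAt.comp u ?_ (pm - ps).hasStrictFDerivAt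
    simpa [u, pm, ps] using hJ.strict
  have h3 := (pc.hasStrictFDerivAt (x := u)).const_mul (2 : ℝ) |>.fun_smul
    (ps.hasStrictFDerivAt (x := u))
  have hF := (h1.add h2).prodMk (((P.hasStrictFDerivAt (x := _)).comp u
    ((h1.sub h2).sub h3)).add (T.hasStrictFDerivAt (x := u)))
  have hF : HasStrictFDerivAt F _ u := hF
  set F' := ((H ∘L (pm + ps)) + (H ∘L (pm - ps))).prod (P ∘L ((H ∘L (pm + ps)) - (H ∘L (pm - ps))
    - ((2 * pc u) • ps + ((2 : ℝ) • pc).smulRight (ps u))) + T) with hF'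
  have hinv : (F' ∘L .inr ℝ (ℝ × ℝ) (E × E)).IsInvertible := by
    have hval : ∀ m s, (F' ∘L .inr ℝ (ℝ × ℝ) (E × E)) (m, s) =
        ((2 : ℝ) • H m, P ((2 : ℝ) • (H s - c₀ • s)) + (inner ℝ v s : ℝ) • v) := fun m s => by
      simp only [hF', ContinuousLinearMap.comp_apply, ContinuousLinearMap.inr_apply,
        ContinuousLinearMap.prod_apply, Prod.mk.injEq]
      constructor
      · simp [pm, ps]
        module
      · simp [pm, ps, pc, pa, T, u]
        module
    have hinj : Function.Injective (F' ∘L .inr ℝ (ℝ × ℝ) (E × E)) := by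
      rw [injective_iff_map_eq_zero]
      rintro ⟨m, s⟩ h
      rw [hval, Prod.mk_eq_zero] at h
      obtain ⟨k, -, hk⟩ := hJ.bounded_below
      obtain ⟨ρ, hρ0, hρ1, hρ⟩ := hJ.contract
      have hm : m = 0 := by
        have := hk m
        rw [(smul_eq_zero_iff_right (two_ne_zero (α := ℝ))).1 h.1] at this
        simpa using this
      have hvs : inner ℝ v s = (0 : ℝ) := by
        have := congrArg (fun x => (inner ℝ v x : ℝ)) h.2
        simp only [inner_add_right, hvP, inner_smul_right, hvv, inner_zero_right] at this
        simpa only [zero_add, mul_one] using this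
      have hHs : H s = c₀ • s := by
        have h0 : inner ℝ v ((2 : ℝ) • (H s - c₀ • s)) = (0 : ℝ) := by
          rw [inner_smul_right, inner_sub_right, ← hJ.H_symm, hJ.H_v, inner_smul_left,
            inner_smul_right, hvs]
          simp
        have := h.2
        rw [hvs, hP, h0, zero_smul, sub_zero, add_zero] at this
        exact sub_eq_zero.1 ((smul_eq_zero_iff_right (two_ne_zero (α := ℝ))).1 this)
      have hs : s = 0 := by
        have h1 := hρ s hvs
        have hc := hJ.pos
        rw [hHs, smul_smul, div_mul_cancel₀ _ hc.ne'] at h1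
        have h2 : s - (2 : ℝ) • s = -s := by module
        rw [h2, norm_neg] at h1
        have : ‖s‖ ≤ 0 := by nlinarith [norm_nonneg s]
        exact norm_le_zero_iff.1 this
      rw [hm, hs, Prod.mk_zero_zero]
    refine ⟨(LinearEquiv.ofInjectiveEndo _ hinj).toContinuousLinearEquiv, ?_⟩
    ext x <;> rfl
  have hFu : F u = 0 := by
    simp [F, u, pm, ps, pa, T, hJ.map_zero]
  refine ⟨hF.implicitFunctionOfProdDomain hinv, hF.tendsto_implicitFunctionOfProdDomain hinv,
    ?_, ?_⟩
  · -- a strictly differentiable function is Lipschitz, hence continuous, near the point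
    obtain ⟨K, t, ht, hK⟩ :=
      (hF.hasStrictFDerivAt_implicitFunctionOfProdDomain hinv).exists_lipschitzOnWith
    filter_upwards [eventually_mem_nhds_iff.2 ht] with x hx
    exact hK.continuousOn.continuousAt hx
  · filter_upwards [hF.eventually_apply_implicitFunctionOfProdDomain hinv] with x hx
    rw [hFu] at hx
    generalize hF.implicitFunctionOfProdDomain hinv x = y at hx ⊢
    obtain ⟨hx1, hx2⟩ := Prod.mk_eq_zero.1 hx
    have hT : T (x, y) = (inner ℝ v y.2 - x.1) • v := rfl
    have hxv : inner ℝ v y.2 = x.1 := by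
      have := congrArg (fun x => (inner ℝ v x : ℝ)) hx2
      rw [inner_add_right, hvP, hT, inner_smul_right, hvv] at this
      simpa [sub_eq_zero] using this
    refine ⟨hxv, hx1, ?_⟩
    rw [hT, hxv, sub_self, zero_smul, add_zero, hP] at hx2
    exact sub_eq_zero.1 hx2

/-- In the supercritical case there is a family of genuine two-cycles for `c` slightly below `c₀`,
shrinking to the equilibrium. On the branch of near-cycles the defect is
`2 a (c₀ - c) - 2 κ a³ + o(a³)`, which changes sign near `a = √((c₀ - c) / κ)`. -/
lemma exists_cycles [FiniteDimensional ℝ E] (hJ : IsFlipJet g c₀ v p H B C)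
    (hκ : 0 < flipCoeff v p B C) :
    ∃ m s : ℝ → E, IsNearCycle (𝓝[<] c₀) g c₀ v m s id 0 ∧ ∀ᶠ c in 𝓝[<] c₀, s c ≠ 0 := by
  obtain ⟨φ, hφ0, hφc, hφ⟩ := hJ.exists_branch
  set κ := flipCoeff v p B C
  set D : ℝ × ℝ → E :=
    fun x => g ((φ x).1 + (φ x).2) - g ((φ x).1 - (φ x).2) - (2 * x.2) • (φ x).2 with hD
  set e : ℝ × ℝ → ℝ := fun x => inner ℝ v (D x) with he
  have hm0 : Tendsto (fun x => (φ x).1) (𝓝 (0, c₀)) (𝓝 0) :=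
    (continuous_fst.tendsto (0 : E × E)).comp hφ0
  have hs0 : Tendsto (fun x => (φ x).2) (𝓝 (0, c₀)) (𝓝 0) :=
    (continuous_snd.tendsto (0 : E × E)).comp hφ0
  have hN : IsNearCycle (𝓝 (0, c₀)) g c₀ v (fun x => (φ x).1) (fun x => (φ x).2) Prod.snd e :=
    ⟨hm0, hs0, continuous_snd.tendsto (0, c₀), hφ.mono fun x hx => hx.2.1,
      hφ.mono fun x hx => hx.2.2⟩
  -- continuity of the defect near the bifurcation point
  have hec : ∀ᶠ x in 𝓝 (0, c₀), ContinuousAt e x := by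
    have hg : ∀ᶠ y in 𝓝 (0 : E), ContinuousAt g y :=
      hJ.differentiable.mono fun y hy => hy.continuousAt
    have hp : Tendsto (fun x => (φ x).1 + (φ x).2) (𝓝 (0, c₀)) (𝓝 0) := by simpa using hm0.add hs0
    have hq : Tendsto (fun x => (φ x).1 - (φ x).2) (𝓝 (0, c₀)) (𝓝 0) := by simpa using hm0.sub hs0
    filter_upwards [hφc, hp.eventually hg, hq.eventually hg] with x h1 h2 h3
    have k1 : ContinuousAt (fun x => g ((φ x).1 + (φ x).2)) x :=
      ContinuousAt.comp (f := fun x => (φ x).1 + (φ x).2) h2 (h1.fst.add h1.snd)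
    have k2 : ContinuousAt (fun x => g ((φ x).1 - (φ x).2)) x :=
      ContinuousAt.comp (f := fun x => (φ x).1 - (φ x).2) h3 (h1.fst.sub h1.snd)
    exact continuousAt_const.inner
      ((k1.sub k2).sub ((continuousAt_const.mul continuousAt_snd).smul h1.snd))
  have hred := (hN.reduction hJ).2.2.2.def hκ
  obtain ⟨r, hr, hball⟩ := Metric.eventually_nhds_iff.1 ((hφ.and hec).and hred)
  have hin : ∀ a c : ℝ, |a| < r → |c - c₀| < r → dist (a, c) ((0 : ℝ), c₀) < r := fun a c ha hc => by
    rw [Prod.dist_eq, max_lt_iff, Real.dist_eq, Real.dist_eq, sub_zero]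
    exact ⟨ha, hc⟩
  have hest : ∀ a c : ℝ, 0 < a → a < r → |c - c₀| < r →
      |e (a, c) - (2 * a * (c₀ - c) - 2 * κ * a ^ 3)| ≤ κ * a ^ 3 := fun a c ha har hc => by
    obtain ⟨⟨h1, -⟩, h2⟩ := hball (hin a c (by rwa [abs_of_pos ha]) hc)
    simp only [h1.1, Real.norm_eq_abs] at h2
    rwa [abs_of_pos (by positivity : 0 < a ^ 3)] at h2
  have hroot : Tendsto (fun c => 2 * Real.sqrt ((c₀ - c) / κ)) (𝓝[<] c₀) (𝓝 0) := by
    have : Continuous fun c => 2 * Real.sqrt ((c₀ - c) / κ) := by fun_prop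
    simpa using (this.tendsto c₀).mono_left nhdsWithin_le_nhds
  have hcr : ∀ᶠ c in 𝓝[<] c₀, |c - c₀| < r :=
    nhdsWithin_le_nhds (Metric.ball_mem_nhds c₀ hr)
  have hex : ∀ᶠ c in 𝓝[<] c₀, ∃ a, 0 < a ∧ a ≤ 2 * Real.sqrt ((c₀ - c) / κ) ∧ e (a, c) = 0 := by
    filter_upwards [hroot.eventually (gt_mem_nhds hr), hcr, self_mem_nhdsWithin] with c h1 h2 h3
    have ht : 0 < c₀ - c := sub_pos.2 h3
    set b := Real.sqrt ((c₀ - c) / κ) with hb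
    have hb0 : 0 < b := Real.sqrt_pos.2 (by positivity)
    have hbt : κ * b ^ 2 = c₀ - c := by
      rw [hb, Real.sq_sqrt (by positivity)]
      field_simp
    have hcont : ContinuousOn (fun a => e (a, c)) (Set.Icc (b / 2) (2 * b)) := fun a ha => by
      have hc := (hball (hin a c (by rw [abs_of_pos (by linarith [ha.1])]; linarith [ha.2]) h2)).1.2
      exact (ContinuousAt.comp (f := fun a => (a, c)) hc (by fun_prop)).continuousWithinAt
    have hlow := abs_le.1 (hest (b / 2) c (by linarith) (by linarith) h2)
    have hup := abs_le.1 (hest (2 * b) c (by linarith) h1 h2)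
    have hb3 : 0 < κ * b ^ 3 := by positivity
    have hbt3 : b * (c₀ - c) = κ * b ^ 3 := by rw [← hbt]; ring
    have hlow' : 0 ≤ e (b / 2, c) := by
      have := hlow.1
      nlinarith
    have hup' : e (2 * b, c) ≤ 0 := by
      have := hup.2
      nlinarith
    obtain ⟨a, ha, hae⟩ := intermediate_value_Icc' (by linarith) hcont ⟨hup', hlow'⟩
    exact ⟨a, by linarith [ha.1], ha.2, hae⟩
  obtain ⟨a, ha⟩ := hex.choice
  have ha0 : Tendsto a (𝓝[<] c₀) (𝓝 0) :=
    tendsto_of_tendsto_of_tendsto_of_le_of_le' tendsto_const_nhds hroot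
      (ha.mono fun c hc => hc.1.le) (ha.mono fun c hc => hc.2.1)
  have hac : Tendsto (fun c => (a c, c)) (𝓝[<] c₀) (𝓝 (0, c₀)) :=
    ha0.prodMk_nhds (tendsto_id.mono_left nhdsWithin_le_nhds)
  refine ⟨fun c => (φ (a c, c)).1, fun c => (φ (a c, c)).2,
    ⟨hm0.comp hac, hs0.comp hac, tendsto_id.mono_left nhdsWithin_le_nhds,
      hac.eventually hN.sum_eq, ?_⟩, ?_⟩
  · filter_upwards [hac.eventually hN.diff_eq, ha] with c h1 h2
    rw [Pi.zero_apply, ← h2.2.2]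
    exact h1
  · filter_upwards [hac.eventually hφ, ha] with c h1 h2 h0
    have := h1.1
    rw [h0, inner_zero_right] at this
    exact h2.1.ne this

end IsFlipJet

end Existence

/-! ### The flip jet of a gradient field -/

section Spectral

variable {E : Type*} [NormedAddCommGroup E] [InnerProductSpace ℝ E] [FiniteDimensional ℝ E]

/-- If `H` is symmetric and positive definite with simple top eigenvalue `c₀`, then `1 - (2 / c₀) H`
is a strict contraction on the orthogonal complement of the top eigenvector. -/
lemma exists_contraction_of_simple_top_eigenvalue {H : E →L[ℝ] E} {c₀ : ℝ} {v : E}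
    (hsymm : ∀ x y, inner ℝ (H x) y = inner ℝ x (H y))
    (hpos : ∀ w, w ≠ 0 → 0 < inner ℝ w (H w)) (hc₀ : 0 < c₀)
    (hvec : Module.End.HasEigenvector (H : E →ₗ[ℝ] E) c₀ v)
    (htop : ∀ μ : ℝ, Module.End.HasEigenvalue (H : E →ₗ[ℝ] E) μ → μ ≤ c₀)
    (hsimple : Module.finrank ℝ (Module.End.eigenspace (H : E →ₗ[ℝ] E) c₀) = 1) :
    ∃ ρ : ℝ, 0 ≤ ρ ∧ ρ < 1 ∧ ∀ w, inner ℝ v w = 0 → ‖w - (2 / c₀) • H w‖ ≤ ρ * ‖w‖ := by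
  classical
  have hT : (H : E →ₗ[ℝ] E).IsSymmetric := fun x y => hsymm x y
  let b := hT.eigenvectorBasis (n := Module.finrank ℝ E) rfl
  let ev := hT.eigenvalues (n := Module.finrank ℝ E) rfl
  have hb : ∀ i, H (b i) = ev i • b i := fun i => hT.apply_eigenvectorBasis rfl i
  have hb1 : ∀ i, ‖b i‖ = 1 := fun i => b.orthonormal.1 i
  have hev0 : ∀ i, 0 < ev i := fun i => by
    have h0 : b i ≠ 0 := fun h => by simpa [h] using hb1 i
    have := hpos _ h0
    rwa [hb, inner_smul_right, real_inner_self_eq_norm_sq, hb1, one_pow, mul_one] at this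
  have hevle : ∀ i, ev i ≤ c₀ := fun i => htop _ (hT.hasEigenvalue_eigenvalues rfl i)
  have hevtop : ∀ i, ev i = c₀ → ∀ w, inner ℝ v w = 0 → (inner ℝ (b i) w : ℝ) = 0 := by
    intro i hi w hw
    have hmem : b i ∈ Module.End.eigenspace (H : E →ₗ[ℝ] E) c₀ :=
      Module.End.mem_eigenspace_iff.2 (by rw [← hi]; exact hb i)
    obtain ⟨t, ht⟩ := exists_smul_eq_of_finrank_eq_one hsimple
      (x := ⟨v, hvec.1⟩) (by simpa using hvec.2) ⟨b i, hmem⟩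
    have ht : t • v = b i := congrArg Subtype.val ht
    rw [← ht, inner_smul_left, hw, mul_zero]
  let f : Fin (Module.finrank ℝ E) → NNReal := fun i =>
    if ev i = c₀ then 0 else ‖1 - 2 / c₀ * ev i‖₊
  have hf1 : Finset.univ.sup f < 1 := by
    rw [Finset.sup_lt_iff (by simp)]
    intro i _
    by_cases h : ev i = c₀
    · simp [f, h]
    · simp only [f, h, if_false]
      rw [← NNReal.coe_lt_coe, coe_nnnorm, NNReal.coe_one, Real.norm_eq_abs, abs_lt]
      have h1 : ev i < c₀ := lt_of_le_of_ne (hevle i) h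
      have h2 : 0 < 2 / c₀ * ev i := by have := hev0 i; positivity
      have h3 : 2 / c₀ * ev i < 2 := by
        rw [div_mul_eq_mul_div, div_lt_iff₀ hc₀]
        linarith
      constructor <;> linarith
  refine ⟨(Finset.univ.sup f : NNReal), NNReal.coe_nonneg _, by exact_mod_cast hf1,
    fun w hw => ?_⟩
  refine abs_le_of_sq_le_sq' ?_ (by positivity) |>.2
  rw [← b.sum_sq_norm_inner_right, mul_pow, ← b.sum_sq_norm_inner_right w, Finset.mul_sum]
  refine Finset.sum_le_sum fun i _ => ?_
  have hi : (inner ℝ (b i) (w - (2 / c₀) • H w) : ℝ)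
      = (1 - 2 / c₀ * ev i) * inner ℝ (b i) w := by
    rw [inner_sub_right, inner_smul_right, ← hsymm, hb, inner_smul_left]
    simp only [conj_trivial]
    ring
  rw [hi]
  by_cases h : ev i = c₀
  · rw [hevtop i h w hw]; simp
  · rw [norm_mul, mul_pow]
    have : ‖1 - 2 / c₀ * ev i‖ ≤ (Finset.univ.sup f : NNReal) := by
      have := Finset.le_sup (f := f) (Finset.mem_univ i)
      simp only [f, h, if_false] at this
      exact_mod_cast this
    gcongr

lemma exists_le_mul_norm_of_posDef {H : E →L[ℝ] E} (hpos : ∀ w, w ≠ 0 → 0 < inner ℝ w (H w)) :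
    ∃ k > 0, ∀ x, ‖x‖ ≤ k * ‖H x‖ := by
  have hker : LinearMap.ker (H : E →ₗ[ℝ] E) = ⊥ := by
    rw [LinearMap.ker_eq_bot']
    intro w hw
    by_contra h
    have := hpos w h
    rw [show H w = 0 from hw, inner_zero_right] at this
    exact this.false
  obtain ⟨K, hK, hL⟩ := (H : E →ₗ[ℝ] E).exists_antilipschitzWith hker
  exact ⟨K, by exact_mod_cast hK, fun x => by simpa using hL.le_mul_dist x 0⟩

end Spectral

/-! ### Gradient descent past the edge of stability -/

section GradientDescent

variable {d : ℕ} {L : RSpace d → ℝ} {x : RSpace d}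

lemma TimesDifferentiableAt.isFlipJet (h : TimesDifferentiableAt 4 L x) (hmin : IsLocalMin L x)
    (hpos : ∀ w : RSpace d, w ≠ 0 → 0 < inner ℝ w (hessianOp L x w)) {c₀ : ℝ} (hc₀ : 0 < c₀)
    {v p : RSpace d} (hv : ‖v‖ = 1) (hp : hessianOp L x p = fderiv ℝ (fderiv ℝ (gradient L)) x v v)
    (hvec : Module.End.HasEigenvector (hessianOp L x : RSpace d →ₗ[ℝ] RSpace d) c₀ v)
    (htop : ∀ μ : ℝ, Module.End.HasEigenvalue
      (hessianOp L x : RSpace d →ₗ[ℝ] RSpace d) μ → μ ≤ c₀)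
    (hsimple : Module.finrank ℝ (Module.End.eigenspace
      (hessianOp L x : RSpace d →ₗ[ℝ] RSpace d) c₀) = 1) :
    IsFlipJet (fun y => gradient L (x + y)) c₀ v p (hessianOp L x)
      (fderiv ℝ (fderiv ℝ (gradient L)) x)
      (fderiv ℝ (fderiv ℝ (fderiv ℝ (gradient L))) x) := by
  obtain ⟨g1, g2, g3, -, -, -⟩ := h.gradient_three
  obtain ⟨s1, -, s3⟩ := h.gradient_symm
  obtain ⟨t1, t2⟩ := taylor_of_differentiableAt_three g1 g2 g3
  have ht : Tendsto (fun y : RSpace d => x + y) (𝓝 0) (𝓝 x) := by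
    have : ContinuousAt (fun y : RSpace d => x + y) 0 := by fun_prop
    simpa [ContinuousAt] using this
  have hg0 : gradient L x = 0 := by
    rw [gradient, hmin.fderiv_eq_zero, _root_.map_zero]
  have hstrict : HasStrictFDerivAt (gradient L) (hessianOp L x) (x + 0) := by
    rw [add_zero]
    exact hasStrictFDerivAt_of_hasFDerivAt_of_continuousAt
      (g1.mono fun y hy => hy.hasFDerivAt) g2.self_of_nhds.continuousAt
  have hadd : HasStrictFDerivAt (fun y : RSpace d => x + y)
      (ContinuousLinearMap.id ℝ (RSpace d)) 0 := (hasStrictFDerivAt_id 0).const_add x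
  exact
    { differentiable := by
        filter_upwards [ht.eventually g1] with y hy
        exact ((hasFDerivAt_comp_add_left x).2 hy.hasFDerivAt).differentiableAt
      strict := hstrict.comp 0 hadd
      taylor := t2.congr_left fun y => by rw [hg0, zero_add]; rfl
      taylor_fderiv := t1.congr_left fun y => by rw [fderiv_comp_add_left]; rfl
      pos := hc₀
      norm_v := hv
      H_v := Module.End.mem_eigenspace_iff.1 hvec.1
      H_p := hp
      H_symm := s1
      B_comm := s3
      bounded_below := exists_le_mul_norm_of_posDef hpos
      contract := exists_contraction_of_simple_top_eigenvalue s1 hpos hc₀ hvec htop hsimple }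

variable {c₀ : ℝ} {v p : RSpace d} {H : RSpace d →L[ℝ] RSpace d}
  {B : RSpace d →L[ℝ] RSpace d →L[ℝ] RSpace d}
  {C : RSpace d →L[ℝ] RSpace d →L[ℝ] RSpace d →L[ℝ] RSpace d}

/-- Supercritical case: stable two-cycles exist for all step sizes slightly above `2 / c₀`. -/
lemma IsFlipJet.eventually_hasStableTwoCycleIn
    (hJ : IsFlipJet (fun y => gradient L (x + y)) c₀ v p H B C) (hκ : 0 < flipCoeff v p B C)
    {U : Set (RSpace d)} (hU : U ∈ 𝓝 x) :
    ∀ᶠ c in 𝓝[<] c₀, HasStableTwoCycleIn L (2 / c) U := by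
  obtain ⟨m, s, hN, hs⟩ := hJ.exists_cycles hκ
  have hN' : IsNearCycle (𝓝[<] c₀) (fun y => gradient L (x + y)) c₀ v m (-s) id 0 := by
    simpa using hN.neg
  have hs' : ∀ᶠ c in 𝓝[<] c₀, (-s) c ≠ 0 := hs.mono fun i hi => by simpa using hi
  have hp : Tendsto (fun c => m c + s c) (𝓝[<] c₀) (𝓝 0) := by
    simpa using hN.tendsto_m.add hN.tendsto_s
  have hq : Tendsto (fun c => m c - s c) (𝓝[<] c₀) (𝓝 0) := by
    simpa using hN.tendsto_m.sub hN.tendsto_s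
  have ht : Tendsto (fun y : RSpace d => x + y) (𝓝 0) (𝓝 x) := by
    have : ContinuousAt (fun y : RSpace d => x + y) 0 := by fun_prop
    simpa [ContinuousAt] using this
  have hc : ∀ᶠ c in 𝓝[<] c₀, (0 : ℝ) < c := nhdsWithin_le_nhds (lt_mem_nhds hJ.pos)
  filter_upwards [hs, hN.eventually_hasAdaptedContraction hJ hs hκ,
    hN'.eventually_hasAdaptedContraction hJ hs' hκ, hN.sum_eq, hN.diff_eq,
    hp.eventually hJ.differentiable, hq.eventually hJ.differentiable,
    (ht.comp hp).eventually hU, (ht.comp hq).eventually hU, hc]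
    with c hsc hst hst' hsum hdiff hdp hdq hUp hUq hc
  simp only [id, Pi.zero_apply, zero_smul, Pi.neg_apply, sub_neg_eq_add, ← sub_eq_add_neg]
    at hst hst' hsum hdiff
  have hgp : gradient L (x + (m c + s c)) = c • s c := by
    have h2 : (2 : ℝ) • gradient L (x + (m c + s c)) = (2 : ℝ) • c • s c := by
      rw [smul_smul, ← sub_eq_zero.1 hdiff, two_smul]
      nth_rw 2 [eq_neg_of_add_eq_zero_left hsum]
      abel
    exact smul_right_injective _ two_ne_zero h2
  have hgq : gradient L (x + (m c - s c)) = -(c • s c) := by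
    rw [← hgp]
    exact eq_neg_of_add_eq_zero_right hsum
  have hψp : gdStep L (2 / c) (x + (m c + s c)) = x + (m c - s c) := by
    rw [gdStep, hgp, smul_smul, div_mul_cancel₀ _ hc.ne']
    module
  have hψq : gdStep L (2 / c) (x + (m c - s c)) = x + (m c + s c) := by
    rw [gdStep, hgq, smul_neg, smul_smul, div_mul_cancel₀ _ hc.ne']
    module
  have hder : ∀ y, DifferentiableAt ℝ (fun y => gradient L (x + y)) y →
      HasFDerivAt (gdStep L (2 / c)) (ContinuousLinearMap.id ℝ (RSpace d)
        - (2 / c) • fderiv ℝ (fun y => gradient L (x + y)) y) (x + y) := fun y hy => by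
    have h1 : HasFDerivAt (gradient L) (fderiv ℝ (fun y => gradient L (x + y)) y) (x + y) :=
      (hasFDerivAt_comp_add_left x).1 hy.hasFDerivAt
    exact (hasFDerivAt_id _).sub (h1.const_smul (2 / c))
  have hdp := hder _ hdp
  have hdq := hder _ hdq
  refine ⟨_, hUp, _, hUq, ?_, hψp, hψq, ?_, ?_⟩
  · intro h
    have h2 : (2 : ℝ) • s c = 0 := by
      have := sub_eq_zero.2 h
      rw [← this]
      simp only [Function.comp_apply]
      module
    exact hsc ((smul_eq_zero_iff_right (two_ne_zero (α := ℝ))).1 h2)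
  · refine hst.isAsymptoticallyStableFixedPt ?_ ?_
    · change gdStep L (2 / c) (gdStep L (2 / c) (x + (m c + s c))) = x + (m c + s c)
      rw [hψp, hψq]
    · exact HasFDerivAt.comp (x + (m c + s c)) (by rw [hψp]; exact hdq) hdp
  · refine hst'.isAsymptoticallyStableFixedPt ?_ ?_
    · change gdStep L (2 / c) (gdStep L (2 / c) (x + (m c - s c))) = x + (m c - s c)
      rw [hψq, hψp]
    · exact HasFDerivAt.comp (x + (m c - s c)) (by rw [hψq]; exact hdp) hdq

/-- Subcritical case: for step sizes slightly above `η` there is no two-cycle, stable or not, close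
to the equilibrium. -/
lemma IsFlipJet.exists_not_hasStableTwoCycleIn {η : ℝ} (hη : 0 < η)
    (hJ : IsFlipJet (fun y => gradient L (x + y)) (2 / η) v p H B C)
    (hκ : flipCoeff v p B C < 0) :
    ∃ U ∈ 𝓝 x, ∀ᶠ η' in 𝓝[>] η, ¬ HasStableTwoCycleIn L η' U := by
  let S : Set (RSpace d × RSpace d × ℝ) := {t | η < t.2.2 ∧ t.1 ≠ t.2.1 ∧
    gdStep L t.2.2 t.1 = t.2.1 ∧ gdStep L t.2.2 t.2.1 = t.1}
  let l : Filter (RSpace d × RSpace d × ℝ) := 𝓝 (x, x, η) ⊓ 𝓟 S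
  let m : RSpace d × RSpace d × ℝ → RSpace d := fun t => (1 / 2 : ℝ) • (t.1 + t.2.1) - x
  let s : RSpace d × RSpace d × ℝ → RSpace d := fun t => (1 / 2 : ℝ) • (t.1 - t.2.1)
  have hS : ∀ᶠ t in l, t ∈ S := eventually_inf_principal.2 (.of_forall fun t ht => ht)
  have hm : Tendsto m l (𝓝 0) := by
    have : ContinuousAt m (x, x, η) := by fun_prop
    have h0 : m (x, x, η) = 0 := by simp only [m]; module
    rw [← h0]
    exact this.tendsto.mono_left inf_le_left
  have hs : Tendsto s l (𝓝 0) := by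
    have : ContinuousAt s (x, x, η) := by fun_prop
    have h0 : s (x, x, η) = 0 := by simp [s]
    rw [← h0]
    exact this.tendsto.mono_left inf_le_left
  have hc : Tendsto (fun t : RSpace d × RSpace d × ℝ => 2 / t.2.2) l (𝓝 (2 / η)) := by
    have : ContinuousAt (fun t : RSpace d × RSpace d × ℝ => 2 / t.2.2) (x, x, η) := by
      have : (x, x, η).2.2 ≠ 0 := hη.ne'
      fun_prop (disch := assumption)
    exact this.tendsto.mono_left inf_le_left
  have hgrad : ∀ t ∈ S, gradient L (x + (m t + s t)) = (2 / t.2.2) • s t ∧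
      gradient L (x + (m t - s t)) = -((2 / t.2.2) • s t) := by
    rintro ⟨x₁, x₂, η'⟩ ⟨h1, -, h3, h4⟩
    simp only [gdStep] at h1 h3 h4
    have hη' : η' ≠ 0 := (hη.trans h1).ne'
    have e1 : x + (m (x₁, x₂, η') + s (x₁, x₂, η')) = x₁ := by simp only [m, s]; module
    have e2 : x + (m (x₁, x₂, η') - s (x₁, x₂, η')) = x₂ := by simp only [m, s]; module
    rw [e1, e2]
    have e3 : (2 / η') • s (x₁, x₂, η') = η'⁻¹ • (x₁ - x₂) := by
      simp only [s]
      rw [smul_smul]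
      congr 1
      field_simp
    simp only [e3]
    constructor
    · rw [← h3, sub_sub_cancel, inv_smul_smul₀ hη']
    · rw [← smul_neg, neg_sub, ← h4, sub_sub_cancel, inv_smul_smul₀ hη']
  have hN : IsNearCycle l (fun y => gradient L (x + y)) (2 / η) v m s
      (fun t => 2 / t.2.2) 0 := by
    refine ⟨hm, hs, hc, ?_, ?_⟩
    · filter_upwards [hS] with t ht
      rw [(hgrad t ht).1, (hgrad t ht).2, add_neg_cancel]
    · filter_upwards [hS] with t ht
      rw [(hgrad t ht).1, (hgrad t ht).2, Pi.zero_apply]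
      module
  have hs0 : ∀ᶠ t in l, s t ≠ 0 := by
    filter_upwards [hS] with t ht h0
    exact ht.2.1 (sub_eq_zero.1 ((smul_eq_zero_iff_right (by norm_num)).1 h0))
  obtain ⟨ha, hpar⟩ := hN.parameter_expansion hJ hs0
  -- the bifurcation equation forces the parameter to the wrong side
  have hfalse : ∀ᶠ t in l, False := by
    filter_upwards [ha, hpar.def (by linarith : 0 < -flipCoeff v p B C), hS] with t h1 h2 h3
    have ha2 : 0 < (inner ℝ v (s t) : ℝ) ^ 2 := by positivity
    rw [Real.norm_eq_abs, Real.norm_eq_abs, abs_of_pos ha2] at h2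
    have h4 : 2 / t.2.2 < 2 / η := div_lt_div_of_pos_left two_pos hη h3.1
    have := (abs_le.1 h2).2
    linarith
  have hnot : ∀ᶠ t in 𝓝 x ×ˢ (𝓝 x ×ˢ 𝓝 η), t ∉ S := by
    rw [← nhds_prod_eq, ← nhds_prod_eq]
    exact eventually_inf_principal.1 hfalse
  obtain ⟨P₁, hP₁, P₂₃, hP₂₃, h⟩ := eventually_prod_iff.1 hnot
  obtain ⟨P₂, hP₂, P₃, hP₃, h'⟩ := eventually_prod_iff.1 hP₂₃
  refine ⟨{y | P₁ y ∧ P₂ y}, hP₁.and hP₂, ?_⟩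
  filter_upwards [nhdsWithin_le_nhds hP₃, self_mem_nhdsWithin] with η' h3 h4
  rintro ⟨x₁, hx₁, x₂, hx₂, hne, h12, h21, -, -⟩
  exact h hx₁.1 (h' hx₂.2 h3) ⟨h4, hne, h12, h21⟩

end GradientDescent

theorem mainTheorem1 {d : ℕ} (L : RSpace d → ℝ) (xstar : RSpace d) (η : ℝ) (vmax : RSpace d)
    (hmin : IsLocalMin L xstar)
    (hdiff : TimesDifferentiableAt 4 L xstar)
    (hpos : ∀ w : RSpace d, w ≠ 0 → 0 < inner ℝ w (hessianOp L xstar w))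
    (hvec : Module.End.HasEigenvector
      (hessianOp L xstar : RSpace d →ₗ[ℝ] RSpace d) (2 / η) vmax)
    (htop : ∀ μ : ℝ, Module.End.HasEigenvalue
      (hessianOp L xstar : RSpace d →ₗ[ℝ] RSpace d) μ → μ ≤ 2 / η)
    (hsimple : Module.finrank ℝ (Module.End.eigenspace
      (hessianOp L xstar : RSpace d →ₗ[ℝ] RSpace d) (2 / η)) = 1)
    (hnondeg : iteratedFDeriv ℝ 3 L xstar ![vmax, vmax, qVec L xstar vmax]
      ≠ iteratedFDeriv ℝ 4 L xstar (fun _ => vmax)) :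
    ((∀ U ∈ 𝓝 xstar, ∀ᶠ η' in 𝓝[>] η, HasStableTwoCycleIn L η' U) ↔
      iteratedFDeriv ℝ 3 L xstar ![vmax, vmax, qVec L xstar vmax]
        > iteratedFDeriv ℝ 4 L xstar (fun _ => vmax)) ∧
    ((∀ U ∈ 𝓝 xstar, ∃ᶠ η' in 𝓝[>] η, HasStableTwoCycleIn L η' U) ↔
      iteratedFDeriv ℝ 3 L xstar ![vmax, vmax, qVec L xstar vmax]
        > iteratedFDeriv ℝ 4 L xstar (fun _ => vmax)) := by
  have hvn : 0 < ‖vmax‖ := norm_pos_iff.2 hvec.2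
  have hHv : hessianOp L xstar vmax = (2 / η) • vmax := Module.End.mem_eigenspace_iff.1 hvec.1
  have hc₀ : 0 < 2 / η := by
    have := hpos vmax hvec.2
    rw [hHv, inner_smul_right, real_inner_self_eq_norm_sq] at this
    exact pos_of_mul_pos_left this (by positivity)
  have hη : 0 < η := by
    by_contra h
    exact absurd (div_nonpos_of_nonneg_of_nonpos two_pos.le (not_lt.1 h)) (not_le.2 hc₀)
  obtain ⟨-, -, -, -, e3, e4⟩ := hdiff.gradient_three
  have hBs := hdiff.gradient_symm.2.1
  set B := fderiv ℝ (fderiv ℝ (gradient L)) xstar with hB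
  set C := fderiv ℝ (fderiv ℝ (fderiv ℝ (gradient L))) xstar with hC
  -- the defining equation of `q`
  have hq : hessianOp L xstar (qVec L xstar vmax) = (3 : ℝ) • B vmax vmax := by
    have hinj : Function.Injective (hessianOp L xstar : RSpace d →ₗ[ℝ] RSpace d) := by
      rw [injective_iff_map_eq_zero]
      intro w hw
      by_contra h
      have := hpos w h
      rw [show hessianOp L xstar w = 0 from hw, inner_zero_right] at this
      exact this.false
    have hinv : (hessianOp L xstar).IsInvertible :=
      ⟨(LinearEquiv.ofInjectiveEndo _ hinj).toContinuousLinearEquiv, by ext w; rfl⟩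
    rw [qVec, hdiff.gradient_cubic]
    exact hinv.self_apply_inverse _
  set q := qVec L xstar vmax with hqdef
  -- normalisation of the critical direction
  set r := ‖vmax‖⁻¹ with hr
  have hr0 : 0 < r := inv_pos.2 hvn
  have hv1 : ‖r • vmax‖ = 1 := by rw [norm_smul, hr, norm_inv, norm_norm, inv_mul_cancel₀ hvn.ne']
  have hvec' : Module.End.HasEigenvector
      (hessianOp L xstar : RSpace d →ₗ[ℝ] RSpace d) (2 / η) (r • vmax) :=
    ⟨Submodule.smul_mem _ _ hvec.1, smul_ne_zero hr0.ne' hvec.2⟩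
  have hp : hessianOp L xstar ((r ^ 2 / 3) • q) = B (r • vmax) (r • vmax) := by
    rw [map_smul, hq]
    simp only [map_smul, smul_apply]
    module
  have hJ := hdiff.isFlipJet hmin hpos hc₀ hv1 hp hvec' htop hsimple
  have hκ : flipCoeff (r • vmax) ((r ^ 2 / 3) • q) B C = r ^ 4 / 6 *
      (iteratedFDeriv ℝ 3 L xstar ![vmax, vmax, q]
        - iteratedFDeriv ℝ 4 L xstar (fun _ => vmax)) := by
    have h3 : iteratedFDeriv ℝ 3 L xstar ![vmax, vmax, q] = inner ℝ vmax (B vmax q) := by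
      rw [iteratedFDeriv_three_apply, ← hBs, e3]
      rfl
    have h4 : iteratedFDeriv ℝ 4 L xstar (fun _ => vmax) = inner ℝ vmax (C vmax vmax vmax) := by
      rw [iteratedFDeriv_four_apply, real_inner_comm, e4]
    rw [h3, h4, flipCoeff]
    simp only [map_smul, smul_apply, inner_smul_left, inner_smul_right, conj_trivial]
    ring
  have hr4 : 0 < r ^ 4 / 6 := by positivity
  have hsuper : iteratedFDeriv ℝ 3 L xstar ![vmax, vmax, q]
      > iteratedFDeriv ℝ 4 L xstar (fun _ => vmax) →
      ∀ U ∈ 𝓝 xstar, ∀ᶠ η' in 𝓝[>] η, HasStableTwoCycleIn L η' U := fun hgt U hU => by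
    have hpos' : 0 < flipCoeff (r • vmax) ((r ^ 2 / 3) • q) B C := by
      rw [hκ]
      exact mul_pos hr4 (sub_pos.2 hgt)
    have htend : Tendsto (fun η' : ℝ => 2 / η') (𝓝[>] η) (𝓝[<] (2 / η)) := by
      refine tendsto_nhdsWithin_iff.2 ⟨?_, ?_⟩
      · exact (tendsto_const_nhds.div tendsto_id hη.ne').mono_left nhdsWithin_le_nhds
      · filter_upwards [self_mem_nhdsWithin] with η' h
        exact div_lt_div_of_pos_left two_pos hη h
    filter_upwards [htend.eventually (hJ.eventually_hasStableTwoCycleIn hpos' hU)] with η' h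
    rwa [div_div_cancel₀ two_ne_zero] at h
  have hsub : (∀ U ∈ 𝓝 xstar, ∃ᶠ η' in 𝓝[>] η, HasStableTwoCycleIn L η' U) →
      iteratedFDeriv ℝ 3 L xstar ![vmax, vmax, q]
        > iteratedFDeriv ℝ 4 L xstar (fun _ => vmax) := fun h => by
    by_contra hle
    have hneg : flipCoeff (r • vmax) ((r ^ 2 / 3) • q) B C < 0 := by
      rw [hκ]
      exact mul_neg_of_pos_of_neg hr4 (sub_neg.2 (lt_of_le_of_ne (not_lt.1 hle) hnondeg))
    obtain ⟨U, hU, hno⟩ := hJ.exists_not_hasStableTwoCycleIn hη hneg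
    exact h U hU hno
  exact ⟨⟨fun h => hsub fun U hU => (h U hU).frequently, hsuper⟩,
    ⟨hsub, fun h U hU => (hsuper h U hU).frequently⟩⟩
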